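/- Let $\mathbb{T}=\mathbb{R}/2\pi\mathbb{Z}$ and let $\|\cdot\|_1$ denote the norm of $L_1(\mathbb{T}^2)$ with respect to the normalized Haar measure. A trigonometric polynomial on $\mathbb{T}^2$ is a finite sum $P(x,y)=\sum_{(k,l)\in\mathbb{Z}^2} c_{k,l}\,e^{i(kx+ly)}$ with $c_{k,l}\in\mathbb{C}$; its degree is the largest value of $\max(|k|,|l|)$ over all $(k,l)$ with $c_{k,l}\neq 0$. There is a constant $C>0$ such that for every integer $N\ge 1$ there exists a trigonometric polynomial $P_N$ on $\mathbb{T}^2$ of degree $N$ which satisfies \[ \Big\|\frac{\partial^2}{\partial x^2}P_N\Big\|_1+\Big\|\frac{\partial^2}{\partial y^2}P_N\Big\|_1\le 1 \] but \[ \Big\|\frac{\partial^2}{\partial x\,\partial y}P_N\Big\|_1> C\,(\ln N)^{1/2}. \] -/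

import Mathlib

open MeasureTheory

noncomputable section

/-- The circle `ℝ / 2πℤ`. -/
abbrev Circ : Type := AddCircle (2 * Real.pi)

instance circPeriodPos : Fact (0 < 2 * Real.pi) := ⟨Real.two_pi_pos⟩

/-- The two-dimensional torus `𝕋² = (ℝ / 2πℤ)²`. -/
abbrev Torus2 : Type := Circ × Circ

/-- The normalized Haar measure on `𝕋²` (the product of the Haar probability measures). -/
def torusHaar : Measure Torus2 :=
  (AddCircle.haarAddCircle : Measure Circ).prod (AddCircle.haarAddCircle : Measure Circ)

/-- The `L₁` norm on `𝕋²` with respect to the normalized Haar measure, as an extended real. -/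
def normL1 (f : Torus2 → ℂ) : ENNReal := eLpNorm f 1 torusHaar

/-- The partial derivative in the first variable of a function on the torus. -/
def partialX (f : Torus2 → ℂ) (p : Torus2) : ℂ :=
  deriv (fun t : ℝ => f (p.1 + (t : Circ), p.2)) 0

/-- The partial derivative in the second variable of a function on the torus. -/
def partialY (f : Torus2 → ℂ) (p : Torus2) : ℂ :=
  deriv (fun t : ℝ => f (p.1, p.2 + (t : Circ))) 0

/-- A trigonometric polynomial on `𝕋²`, given by its finitely many nonzero Fourier coefficients
`c (k, l)`, `(k, l) ∈ ℤ²`. -/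
abbrev TrigPoly2 : Type := (ℤ × ℤ) →₀ ℂ

/-- The function `(x, y) ↦ ∑ c (k, l) e^{i (k x + l y)}` on `𝕋²`; for the period `2π`,
`fourier k x` is `e^{i k x}`. -/
def trigFun (c : TrigPoly2) (p : Torus2) : ℂ :=
  c.sum fun k a => a * (fourier k.1 p.1 * fourier k.2 p.2)

/-- The degree: the largest `max (|k|, |l|)` over the frequencies `(k, l)` that occur
(and `0` for the zero polynomial). -/
def trigDegree (c : TrigPoly2) : ℕ :=
  c.support.sup fun k => max k.1.natAbs k.2.natAbs

end

/-! Take the Riesz products R_j = ∏_{i<j} K(φ_i) along the lacunary phases φ_i = q^i (x + (-1)^i y),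
where K is a positive kernel of degree m and mean one. Let s be periodic with s'' = K - 1, and put f
= ∑_{j<n} q^{-2j} s(φ_j) R_j (`potential`). Since R_j varies slowly compared with φ_j, a second
derivative of the j-th term falls mainly on s(φ_j) and gives ε_j (K(φ_j) - 1) R_j = ε_j (R_{j+1} -
R_j). The sign ε_j is 1 for xx and for yy, but (-1)^j for xy. The pure derivatives therefore
telescope to R_n - 1, of norm at most 2 (`integral_norm_le_of_near_telescope`), while the mixed one
is an alternating sum of the increments, of norm at least a multiple of n
(`le_integral_norm_of_near_alternating`).

The lower bound is by duality. With W_k the product of (1 + cos φ_i)/2 over i < k, the integral of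
W_k R_j is explicit (`integral_weightProd_mul_riesz`): each index below both k and j contributes a
factor α, close to 1 when the first coefficients of K are, and each index in [j, k) contributes 1/2.
The function ∑ (-1)^k (W_k - W_{k+1}) is bounded by 1 because W_k decreases within [0, 1], and it
pairs with the signed increments (-1)^j (R_{j+1} - R_j) with one and the same sign for every j
(`integral_testFun_mul`).

The remaining terms of the second derivatives are controlled because K is bounded below: derivatives
of R_j are then dominated pointwise by R_j itself (`tame_riesz`), and each R_j has norm one. Taking
m = 2n and q of order n^5 makes the total error at most 1 (`exists_hasDir2_potential`). The degree
of f is then below exp(16 n²), so n may be taken comparable to (ln N)^{1/2}. A small monomial in x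
alone brings the degree to exactly N, and a single monomial settles small N. -/

/-! ### Trigonometric polynomials as functions on the torus -/

/-- The monomial `e^{i(kx+ly)}` on the torus. -/
noncomputable def mono (k l : ℤ) (p : Torus2) : ℂ := fourier k p.1 * fourier l p.2

/-- Trigonometric polynomials on the torus of degree at most `d`, as functions. -/
def trigSpace (d : ℕ) : Submodule ℂ (Torus2 → ℂ) :=
  Submodule.span ℂ {f | ∃ k l : ℤ, |k| ≤ d ∧ |l| ≤ d ∧ f = mono k l}

theorem mono_mem_trigSpace {k l : ℤ} {d : ℕ} (hk : |k| ≤ d) (hl : |l| ≤ d) :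
    mono k l ∈ trigSpace d := Submodule.subset_span ⟨k, l, hk, hl, rfl⟩

theorem trigSpace_mono {d e : ℕ} (h : d ≤ e) : trigSpace d ≤ trigSpace e := by
  apply Submodule.span_mono
  rintro f ⟨k, l, hk, hl, rfl⟩
  have : (d : ℤ) ≤ e := by exact_mod_cast h
  exact ⟨k, l, hk.trans this, hl.trans this, rfl⟩

theorem mono_mul (k l k' l' : ℤ) (p : Torus2) :
    mono k l p * mono k' l' p = mono (k + k') (l + l') p := by
  simp only [mono, fourier_add]; ring

theorem mono_zero (p : Torus2) : mono 0 0 p = 1 := by simp [mono]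

theorem one_mem_trigSpace (d : ℕ) : (1 : Torus2 → ℂ) ∈ trigSpace d := by
  have : (1 : Torus2 → ℂ) = mono 0 0 := by
    funext p; simp [mono_zero]
  rw [this]
  exact mono_mem_trigSpace (by simp) (by simp)

theorem mul_mem_trigSpace {d e : ℕ} {f g : Torus2 → ℂ} (hf : f ∈ trigSpace d)
    (hg : g ∈ trigSpace e) : f * g ∈ trigSpace (d + e) := by
  induction hf using Submodule.span_induction with
  | zero => simp
  | add a b _ _ ha hb => rw [add_mul]; exact add_mem ha hb
  | smul c a _ ha => rw [smul_mul_assoc]; exact Submodule.smul_mem _ _ ha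
  | mem a ha =>
    obtain ⟨k, l, hk, hl, rfl⟩ := ha
    induction hg using Submodule.span_induction with
    | zero => simp
    | add a b _ _ ha hb => rw [mul_add]; exact add_mem ha hb
    | smul c a _ ha => rw [mul_smul_comm]; exact Submodule.smul_mem _ _ ha
    | mem a ha =>
      obtain ⟨k', l', hk', hl', rfl⟩ := ha
      have : mono k l * mono k' l' = mono (k + k') (l + l') := by
        funext p; simp [mono_mul]
      rw [this]
      exact mono_mem_trigSpace (by push_cast; exact (abs_add_le _ _).trans (add_le_add hk hk'))
        (by push_cast; exact (abs_add_le _ _).trans (add_le_add hl hl'))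

theorem continuous_mono (k l : ℤ) : Continuous (mono k l) :=
  ((fourier k).continuous.comp continuous_fst).mul ((fourier l).continuous.comp continuous_snd)

theorem continuous_of_mem_trigSpace {d : ℕ} {f : Torus2 → ℂ} (hf : f ∈ trigSpace d) :
    Continuous f := by
  induction hf using Submodule.span_induction with
  | zero => exact continuous_const
  | add a b _ _ ha hb => exact ha.add hb
  | smul c a _ ha => exact ha.const_smul c
  | mem a ha =>
    obtain ⟨k, l, hk, hl, rfl⟩ := ha
    exact continuous_mono k l

theorem trigFun_add (a b : TrigPoly2) : trigFun (a + b) = trigFun a + trigFun b := by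
  funext p
  simp only [trigFun, Pi.add_apply]
  exact Finsupp.sum_add_index' (by simp) (by intros; ring)

theorem trigFun_smul (z : ℂ) (a : TrigPoly2) : trigFun (z • a) = z • trigFun a := by
  funext p
  simp only [trigFun, Pi.smul_apply]
  rw [Finsupp.sum_smul_index' (by simp), Finsupp.smul_sum]
  simp only [smul_eq_mul, mul_assoc]

theorem trigFun_single (k l : ℤ) (z : ℂ) :
    trigFun (Finsupp.single (k, l) z) = z • mono k l := by
  funext p
  simp [trigFun, mono, Finsupp.sum_single_index]

/-- Every function in `trigSpace d` has a coefficient family supported in the square of size `d`. -/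
theorem exists_coeff_of_mem_trigSpace {d : ℕ} {f : Torus2 → ℂ} (hf : f ∈ trigSpace d) :
    ∃ c : TrigPoly2, trigFun c = f ∧ ∀ k l : ℤ, c (k, l) ≠ 0 → |k| ≤ d ∧ |l| ≤ d := by
  induction hf using Submodule.span_induction with
  | zero => exact ⟨0, by funext p; simp [trigFun], by simp⟩
  | add a b _ _ ha hb =>
    obtain ⟨c, hc, hc'⟩ := ha
    obtain ⟨e, he, he'⟩ := hb
    refine ⟨c + e, by rw [trigFun_add, hc, he], fun k l h => ?_⟩
    by_cases h1 : c (k, l) = 0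
    · apply he'
      intro h2
      exact h (by simp [h1, h2])
    · exact hc' k l h1
  | smul z a _ ha =>
    obtain ⟨c, hc, hc'⟩ := ha
    refine ⟨z • c, by rw [trigFun_smul, hc], fun k l h => hc' k l fun h1 => h (by simp [h1])⟩
  | mem a ha =>
    obtain ⟨k, l, hk, hl, rfl⟩ := ha
    refine ⟨Finsupp.single (k, l) 1, by rw [trigFun_single, one_smul], fun k' l' h => ?_⟩
    have h1 : (k, l) = (k', l') := by
      by_contra h2
      exact h (Finsupp.single_eq_of_ne (Ne.symm h2))
    simp only [Prod.mk.injEq] at h1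
    obtain ⟨rfl, rfl⟩ := h1
    exact ⟨hk, hl⟩

/-! ### Integration on the torus and decorrelation from fast phases -/

instance : IsProbabilityMeasure torusHaar := by
  unfold torusHaar; infer_instance

theorem integrable_torusHaar_of_continuous {E : Type*} [NormedAddCommGroup E] {f : Torus2 → E}
    (hf : Continuous f) : Integrable f torusHaar := by
  have := hf.integrable_of_hasCompactSupport (μ := torusHaar)
    (HasCompactSupport.of_compactSpace f)
  exact this

theorem integral_fourier_haar (k : ℤ) :
    ∫ x : Circ, fourier k x ∂AddCircle.haarAddCircle = if k = 0 then 1 else 0 := by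
  have := congrFun (fourierCoeff_fourier (T := 2 * Real.pi) k) 0
  simp only [fourierCoeff, neg_zero, fourier_zero, smul_eq_mul, one_mul] at this
  rw [this, Pi.single_apply]
  simp only [eq_comm]

theorem integral_mono_torusHaar (k l : ℤ) :
    ∫ p, mono k l p ∂torusHaar = if k = 0 ∧ l = 0 then 1 else 0 := by
  unfold mono torusHaar
  rw [integral_prod_mul (μ := AddCircle.haarAddCircle) (ν := AddCircle.haarAddCircle)
    (fun x : Circ => (fourier k x : ℂ)) (fun x : Circ => (fourier l x : ℂ)),
    integral_fourier_haar, integral_fourier_haar]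
  split_ifs <;> simp_all

/-- A one-variable trigonometric polynomial of degree at most `m`. -/
noncomputable def trigPoly1 (m : ℕ) (a : ℤ → ℂ) (x : Circ) : ℂ :=
  ∑ k ∈ Finset.Icc (-m : ℤ) m, a k * fourier k x

/-- The linear form `Ax + By` on the torus. -/
noncomputable def linForm (A B : ℤ) (p : Torus2) : Circ := A • p.1 + B • p.2

theorem fourier_linForm (A B k : ℤ) (p : Torus2) :
    (fourier k (linForm A B p) : ℂ) = mono (k * A) (k * B) p := by
  simp only [linForm, mono, fourier_apply, smul_add, smul_smul, AddCircle.toCircle_add,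
    Circle.coe_mul]

theorem trigPoly1_linForm_mem {m D : ℕ} {A B : ℤ} (hA : |A| ≤ D) (hB : |B| ≤ D) (a : ℤ → ℂ) :
    (fun p => trigPoly1 m a (linForm A B p)) ∈ trigSpace (m * D) := by
  have : (fun p => trigPoly1 m a (linForm A B p)) =
      ∑ k ∈ Finset.Icc (-m : ℤ) m, a k • mono (k * A) (k * B) := by
    funext p
    simp only [trigPoly1, fourier_linForm, Finset.sum_apply, Pi.smul_apply, smul_eq_mul]
  rw [this]
  refine Submodule.sum_mem _ fun k hk => Submodule.smul_mem _ _ ?_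
  rw [Finset.mem_Icc, ← abs_le] at hk
  apply mono_mem_trigSpace
  · rw [abs_mul]; push_cast; gcongr
  · rw [abs_mul]; push_cast; gcongr

/-- A polynomial of degree less than `A` is uncorrelated with any function of `Ax + By`. -/
theorem integral_mul_fourier_linForm {d : ℕ} {g : Torus2 → ℂ} (hg : g ∈ trigSpace d) {A B k : ℤ}
    (hA : (d : ℤ) < A) :
    ∫ p, g p * fourier k (linForm A B p) ∂torusHaar =
      (if k = 0 then 1 else 0) * ∫ p, g p ∂torusHaar := by
  have hc : Continuous fun p => (fourier k (linForm A B p) : ℂ) := by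
    simp only [fourier_linForm]
    exact continuous_mono _ _
  induction hg using Submodule.span_induction with
  | zero => simp
  | add a b ha' hb' ha hb =>
    have h1 := continuous_of_mem_trigSpace ha'
    have h2 := continuous_of_mem_trigSpace hb'
    have i1 := integrable_torusHaar_of_continuous
      (f := fun p => a p * fourier k (linForm A B p)) (h1.mul hc)
    have i2 := integrable_torusHaar_of_continuous
      (f := fun p => b p * fourier k (linForm A B p)) (h2.mul hc)
    simp only [Pi.add_apply, add_mul]
    rw [integral_add i1 i2, integral_add (integrable_torusHaar_of_continuous h1)
      (integrable_torusHaar_of_continuous h2), ha, hb, mul_add]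
  | smul c a _ ha =>
    simp only [Pi.smul_apply, smul_eq_mul, mul_assoc, integral_const_mul, ha]
    ring
  | mem a ha =>
    obtain ⟨k', l', hk, hl, rfl⟩ := ha
    by_cases h0 : k = 0
    · simp [h0]
    · simp only [fourier_linForm, mono_mul, integral_mono_torusHaar]
      rw [if_neg, if_neg h0, zero_mul]
      rintro ⟨h1, -⟩
      -- A vanishing x-frequency is impossible, since |k'| ≤ d < A ≤ |k A|.
      have h2 : |k * A| = |k'| := by
        rw [show k * A = -k' by linarith, abs_neg]
      rw [abs_mul] at h2
      have h3 : 1 ≤ |k| := Int.one_le_abs h0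
      have h4 : A ≤ |A| := le_abs_self A
      have h5 : 0 ≤ |A| := abs_nonneg A
      nlinarith

/-- Against a slow factor only the constant Fourier mode of the fast factor survives, and the twist
by s moves the coefficient at -s there. With s = 0, 1, -1 this evaluates all integrals of kernels
against weights. -/
theorem integral_mul_fourier_mul_trigPoly1 {d m : ℕ} {g : Torus2 → ℂ} (hg : g ∈ trigSpace d)
    {A B s : ℤ} (hs : |s| ≤ m) (hA : (d : ℤ) < A) (a : ℤ → ℂ) :
    ∫ p, g p * (fourier s (linForm A B p) * trigPoly1 m a (linForm A B p)) ∂torusHaar =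
      a (-s) * ∫ p, g p ∂torusHaar := by
  have hgc := continuous_of_mem_trigSpace hg
  have hc : ∀ k, Continuous fun p => (fourier k (linForm A B p) : ℂ) := by
    intro k
    simp only [fourier_linForm]
    exact continuous_mono _ _
  have h1 : ∀ p, g p * (fourier s (linForm A B p) * trigPoly1 m a (linForm A B p)) =
      ∑ k ∈ Finset.Icc (-m : ℤ) m, a k * (g p * fourier (k + s) (linForm A B p)) := by
    intro p
    simp only [trigPoly1, Finset.mul_sum, fourier_add]
    exact Finset.sum_congr rfl fun k _ => by ring
  have hi : ∀ k, Integrable (fun p => a k * (g p * fourier (k + s) (linForm A B p))) torusHaar :=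
    fun k => integrable_torusHaar_of_continuous (continuous_const.mul (hgc.mul (hc _)))
  simp only [h1]
  rw [integral_finsetSum _ fun k _ => hi k]
  simp only [integral_const_mul, integral_mul_fourier_linForm hg hA]
  rw [Finset.sum_eq_single (-s)]
  · simp
  · intro k _ hk
    rw [if_neg (by intro h; apply hk; linarith)]
    simp
  · intro h
    exact absurd (Finset.mem_Icc.2 (abs_le.1 (by simpa using hs))) h

/-! ### Directional derivatives -/

/-- The displacement by `t` in the direction `v`. -/
noncomputable def dirShift (v : ℤ × ℤ) (t : ℝ) : Torus2 :=
  (((v.1 * t : ℝ) : Circ), ((v.2 * t : ℝ) : Circ))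

theorem dirShift_zero (v : ℤ × ℤ) : dirShift v 0 = 0 := by
  simp [dirShift]

/-- `f'` is the derivative of `f` in the direction `v`. -/
def HasDir (v : ℤ × ℤ) (f f' : Torus2 → ℂ) : Prop :=
  ∀ p, HasDerivAt (fun t : ℝ => f (p + dirShift v t)) (f' p) 0

theorem fourier_circ_coe (k : ℤ) (x : ℝ) :
    (fourier k (x : Circ) : ℂ) = Complex.exp (k * x * Complex.I) := by
  rw [fourier_coe_apply]
  congr 1
  have : (Real.pi : ℂ) ≠ 0 := by exact_mod_cast Real.pi_ne_zero
  push_cast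
  field_simp

theorem fourier_add_apply (k : ℤ) (x y : Circ) :
    (fourier k (x + y) : ℂ) = fourier k x * fourier k y := by
  simp only [fourier_apply, smul_add, AddCircle.toCircle_add, Circle.coe_mul]

theorem mono_add_dirShift (k l : ℤ) (v : ℤ × ℤ) (p : Torus2) (t : ℝ) :
    mono k l (p + dirShift v t) =
      mono k l p * Complex.exp ((k * v.1 + l * v.2 : ℤ) * Complex.I * t) := by
  simp only [mono, dirShift, Prod.fst_add, Prod.snd_add, fourier_add_apply, fourier_circ_coe]
  rw [show ∀ a b c d : ℂ, a * b * (c * d) = a * c * (b * d) by intros; ring, ← Complex.exp_add]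
  congr 2
  push_cast
  ring

theorem hasDir_mono (v : ℤ × ℤ) (k l : ℤ) :
    HasDir v (mono k l) (fun p => (k * v.1 + l * v.2 : ℤ) * Complex.I * mono k l p) := by
  intro p
  simp only [mono_add_dirShift]
  have h1 : HasDerivAt (fun t : ℂ => Complex.exp ((k * v.1 + l * v.2 : ℤ) * Complex.I * t))
      (Complex.exp ((k * v.1 + l * v.2 : ℤ) * Complex.I * (0 : ℝ)) *
        ((k * v.1 + l * v.2 : ℤ) * Complex.I * 1)) ((0 : ℝ) : ℂ) :=
    ((hasDerivAt_id _).const_mul _).cexp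
  have h2 := (h1.comp_ofReal).const_mul (mono k l p)
  refine HasDerivAt.congr_deriv h2 ?_
  rw [Complex.ofReal_zero, mul_zero, Complex.exp_zero]
  ring

theorem HasDir.add {v : ℤ × ℤ} {f f' g g' : Torus2 → ℂ} (hf : HasDir v f f')
    (hg : HasDir v g g') : HasDir v (f + g) (f' + g') := fun p => (hf p).add (hg p)

theorem HasDir.sum {ι : Type*} {v : ℤ × ℤ} {s : Finset ι} {f f' : ι → Torus2 → ℂ}
    (h : ∀ i ∈ s, HasDir v (f i) (f' i)) : HasDir v (∑ i ∈ s, f i) (∑ i ∈ s, f' i) := by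
  intro p
  simp only [Finset.sum_apply]
  exact HasDerivAt.fun_sum fun i hi => h i hi p

theorem HasDir.smul {v : ℤ × ℤ} {f f' : Torus2 → ℂ} (c : ℂ) (hf : HasDir v f f') :
    HasDir v (c • f) (c • f') := fun p => (hf p).const_mul c

theorem HasDir.mul {v : ℤ × ℤ} {f f' g g' : Torus2 → ℂ} (hf : HasDir v f f')
    (hg : HasDir v g g') : HasDir v (f * g) (f' * g + f * g') := by
  intro p
  have := (hf p).mul (hg p)
  simp only [dirShift_zero, add_zero] at this
  exact this

theorem HasDir.partialX_eq {f f' : Torus2 → ℂ} (h : HasDir (1, 0) f f') : partialX f = f' := by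
  funext p
  have := (h p).deriv
  simpa [dirShift, partialX, Prod.add_def] using this

theorem HasDir.partialY_eq {f f' : Torus2 → ℂ} (h : HasDir (0, 1) f f') : partialY f = f' := by
  funext p
  have := (h p).deriv
  simpa [dirShift, partialY, Prod.add_def] using this

theorem hasDir_trigPoly1_linForm (v : ℤ × ℤ) (m : ℕ) (a : ℤ → ℂ) (A B : ℤ) :
    HasDir v (fun p => trigPoly1 m a (linForm A B p))
      (fun p => (A * v.1 + B * v.2 : ℤ) *
        trigPoly1 m (fun k => k * Complex.I * a k) (linForm A B p)) := by
  have h := HasDir.sum (s := Finset.Icc (-m : ℤ) m) (v := v)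
    fun k _ => (hasDir_mono v (k * A) (k * B)).smul (a k)
  have e1 : (∑ k ∈ Finset.Icc (-m : ℤ) m, a k • mono (k * A) (k * B)) =
      fun p => trigPoly1 m a (linForm A B p) := by
    funext p
    simp only [trigPoly1, fourier_linForm, Finset.sum_apply, Pi.smul_apply, smul_eq_mul]
  rw [e1] at h
  convert h using 1
  funext p
  simp only [trigPoly1, fourier_linForm, Finset.sum_apply, Pi.smul_apply, smul_eq_mul,
    Finset.mul_sum]
  refine Finset.sum_congr rfl fun k _ => ?_
  push_cast
  ring

/-- `g` is the second derivative of `f`, first in the direction `w` and then in `v`. -/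
def HasDir2 (v w : ℤ × ℤ) (f g : Torus2 → ℂ) : Prop :=
  ∃ h, HasDir w f h ∧ HasDir v h g

theorem HasDir2.add {v w : ℤ × ℤ} {f f' g g' : Torus2 → ℂ} (hf : HasDir2 v w f f')
    (hg : HasDir2 v w g g') : HasDir2 v w (f + g) (f' + g') := by
  obtain ⟨a, h1, h2⟩ := hf
  obtain ⟨b, h3, h4⟩ := hg
  exact ⟨a + b, h1.add h3, h2.add h4⟩

theorem HasDir2.smul {v w : ℤ × ℤ} {f f' : Torus2 → ℂ} (c : ℂ) (hf : HasDir2 v w f f') :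
    HasDir2 v w (c • f) (c • f') := by
  obtain ⟨a, h1, h2⟩ := hf
  exact ⟨c • a, h1.smul c, h2.smul c⟩

theorem HasDir2.sum {ι : Type*} {v w : ℤ × ℤ} {s : Finset ι} {f f' : ι → Torus2 → ℂ}
    (h : ∀ i ∈ s, HasDir2 v w (f i) (f' i)) : HasDir2 v w (∑ i ∈ s, f i) (∑ i ∈ s, f' i) := by
  classical
  choose! a ha using h
  exact ⟨∑ i ∈ s, a i, HasDir.sum fun i hi => (ha i hi).1, HasDir.sum fun i hi => (ha i hi).2⟩

theorem hasDir2_mono (v w : ℤ × ℤ) (k l : ℤ) :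
    HasDir2 v w (mono k l)
      ((-((k * v.1 + l * v.2) * (k * w.1 + l * w.2)) : ℂ) • mono k l) := by
  refine ⟨_, hasDir_mono w k l, ?_⟩
  have h := (hasDir_mono v k l).smul ((k * w.1 + l * w.2 : ℤ) * Complex.I)
  have e : ((-((k * v.1 + l * v.2) * (k * w.1 + l * w.2)) : ℂ) • mono k l) =
      ((k * w.1 + l * w.2 : ℤ) * Complex.I : ℂ) •
        (fun p => (k * v.1 + l * v.2 : ℤ) * Complex.I * mono k l p) := by
    funext p
    simp only [Pi.smul_apply, smul_eq_mul]
    push_cast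
    linear_combination
      (-((k * v.1 + l * v.2) * (k * w.1 + l * w.2) * mono k l p : ℂ)) * Complex.I_mul_I
  rw [e]
  exact h

theorem HasDir2.partialX_partialX {f g : Torus2 → ℂ} (h : HasDir2 (1, 0) (1, 0) f g) :
    partialX (partialX f) = g := by
  obtain ⟨a, h1, h2⟩ := h
  rw [h1.partialX_eq, h2.partialX_eq]

theorem HasDir2.partialY_partialY {f g : Torus2 → ℂ} (h : HasDir2 (0, 1) (0, 1) f g) :
    partialY (partialY f) = g := by
  obtain ⟨a, h1, h2⟩ := h
  rw [h1.partialY_eq, h2.partialY_eq]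

theorem HasDir2.partialX_partialY {f g : Torus2 → ℂ} (h : HasDir2 (1, 0) (0, 1) f g) :
    partialX (partialY f) = g := by
  obtain ⟨a, h1, h2⟩ := h
  rw [h1.partialY_eq, h2.partialX_eq]

/-! ### Slowly varying factors and the product rule -/

/-- The derivatives of `f` up to order two are dominated pointwise by `f` itself:
each differentiation costs a factor `K`. -/
def Tame (v w : ℤ × ℤ) (f : Torus2 → ℂ) (K : ℝ) : Prop :=
  ∃ fv fw fvw, HasDir v f fv ∧ HasDir w f fw ∧ HasDir v fw fvw ∧
    ∀ p, ‖fv p‖ ≤ K * ‖f p‖ ∧ ‖fw p‖ ≤ K * ‖f p‖ ∧ ‖fvw p‖ ≤ K ^ 2 * ‖f p‖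

theorem tame_one (v w : ℤ × ℤ) : Tame v w 1 0 := by
  have h (v : ℤ × ℤ) : HasDir v 1 0 := fun p => hasDerivAt_const _ _
  have h' (v : ℤ × ℤ) : HasDir v 0 0 := fun p => hasDerivAt_const _ _
  exact ⟨0, 0, 0, h v, h w, h' v, by simp⟩

/-- By the Leibniz rule the rates add: the four second-order terms have rates K², KL, KL and L²,
which sum to (K + L)². -/
theorem Tame.mul {v w : ℤ × ℤ} {f g : Torus2 → ℂ} {K L : ℝ} (hf : Tame v w f K)
    (hg : Tame v w g L) : Tame v w (f * g) (K + L) := by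
  obtain ⟨fv, fw, fvw, f1, f2, f3, f4⟩ := hf
  obtain ⟨gv, gw, gvw, g1, g2, g3, g4⟩ := hg
  refine ⟨_, _, _, f1.mul g1, f2.mul g2, (f3.mul g1).add (f1.mul g3), fun p => ?_⟩
  obtain ⟨a1, a2, a3⟩ := f4 p
  obtain ⟨b1, b2, b3⟩ := g4 p
  simp only [Pi.add_apply, Pi.mul_apply, norm_mul]
  have key {x y c d : ℂ} {X Y C D : ℝ} (hx : ‖x‖ ≤ X) (hy : ‖y‖ ≤ Y) (hc : ‖c‖ ≤ C)
      (hd : ‖d‖ ≤ D) : ‖x * y + c * d‖ ≤ X * Y + C * D := by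
    refine (norm_add_le _ _).trans ?_
    rw [norm_mul, norm_mul]
    have := norm_nonneg x
    have := norm_nonneg y
    have := norm_nonneg c
    have := norm_nonneg d
    gcongr <;> linarith
  refine ⟨(key a1 le_rfl le_rfl b1).trans_eq (by ring),
    (key a2 le_rfl le_rfl b2).trans_eq (by ring), ?_⟩
  refine (norm_add_le _ _).trans ?_
  refine (add_le_add (key a3 le_rfl a2 b1) (key a1 b2 le_rfl b3)).trans_eq ?_
  ring

/-- The main term and the error for the second derivatives of `N⁻² s(Ax + By) R(x, y)` when `R`
varies slowly compared with `N`. -/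
theorem exists_hasDir2_piece {v w : ℤ × ℤ} {A B : ℤ} {N S K : ℝ} {σ τ : ℤ} {m : ℕ} {s : ℤ → ℂ}
    {R : Torus2 → ℂ} (hN : 0 < N) (hS : 0 ≤ S)
    (hv : ((A * v.1 + B * v.2 : ℤ) : ℂ) = σ * N) (hw : ((A * w.1 + B * w.2 : ℤ) : ℂ) = τ * N)
    (hσ : |σ| ≤ 1) (hτ : |τ| ≤ 1) (hs : ∀ x, ‖trigPoly1 m s x‖ ≤ S)
    (hs' : ∀ x, ‖trigPoly1 m (fun k => k * Complex.I * s k) x‖ ≤ S) (hR : Tame v w R K) :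
    ∃ E : Torus2 → ℂ, HasDir2 v w
      ((N ^ 2 : ℂ)⁻¹ • ((fun p => trigPoly1 m s (linForm A B p)) * R))
      (((σ * τ : ℤ) : ℂ) • ((fun p => trigPoly1 m
        (fun k => k * Complex.I * (k * Complex.I * s k)) (linForm A B p)) * R) + E) ∧
      ∀ p, ‖E p‖ ≤ S * (2 * (K / N) + (K / N) ^ 2) * ‖R p‖ := by
  obtain ⟨Rv, Rw, Rvw, h1, h2, h3, h4⟩ := hR
  have hN0 : (N : ℂ) ≠ 0 := by exact_mod_cast hN.ne'
  have hτ' : ‖(τ : ℂ)‖ ≤ 1 := by rw [Complex.norm_intCast]; exact_mod_cast hτ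
  have hσ' : ‖(σ : ℂ)‖ ≤ 1 := by rw [Complex.norm_intCast]; exact_mod_cast hσ
  set s0 : Torus2 → ℂ := fun p => trigPoly1 m s (linForm A B p) with hs0
  set s1 : Torus2 → ℂ := fun p => trigPoly1 m (fun k => k * Complex.I * s k) (linForm A B p)
    with hs1
  set s2 : Torus2 → ℂ := fun p => trigPoly1 m
        (fun k => k * Complex.I * (k * Complex.I * s k)) (linForm A B p) with hs2
  have d0w : HasDir w s0 ((τ * N : ℂ) • s1) := by
    have := hasDir_trigPoly1_linForm w m s A B
    rwa [hw] at this
  have d0v : HasDir v s0 ((σ * N : ℂ) • s1) := by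
    have := hasDir_trigPoly1_linForm v m s A B
    rwa [hv] at this
  have d1v : HasDir v s1 ((σ * N : ℂ) • s2) := by
    have := hasDir_trigPoly1_linForm v m (fun k => k * Complex.I * s k) A B
    rwa [hv] at this
  have D := (((d1v.smul (τ * N : ℂ)).mul h1).add (d0v.mul h3)).smul ((N ^ 2 : ℂ)⁻¹)
  -- The error consists of the Leibniz terms in which `R` is differentiated: once, of relative size
  -- K/N, in the two cross terms, and twice, of relative size (K/N)², in the last one.
  refine ⟨fun p => (N : ℂ)⁻¹ * (τ * s1 p * Rv p) + (N : ℂ)⁻¹ * (σ * s1 p * Rw p) +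
    (N ^ 2 : ℂ)⁻¹ * (s0 p * Rvw p), ⟨_, (d0w.mul h2).smul _, ?_⟩, ?_⟩
  · convert D using 1
    ext p
    simp only [Pi.add_apply, Pi.smul_apply, Pi.mul_apply, smul_eq_mul]
    push_cast
    field_simp
    ring
  · intro p
    obtain ⟨a1, a2, a3⟩ := h4 p
    have b0 : ‖s0 p‖ ≤ S := hs _
    have b1 : ‖s1 p‖ ≤ S := hs' _
    have t1 : ‖(N : ℂ)⁻¹ * (τ * s1 p * Rv p)‖ ≤ N⁻¹ * (1 * S * (K * ‖R p‖)) := by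
      rw [norm_mul, norm_mul, norm_mul, norm_inv, Complex.norm_real, Real.norm_of_nonneg hN.le]
      gcongr
    have t2 : ‖(N : ℂ)⁻¹ * (σ * s1 p * Rw p)‖ ≤ N⁻¹ * (1 * S * (K * ‖R p‖)) := by
      rw [norm_mul, norm_mul, norm_mul, norm_inv, Complex.norm_real, Real.norm_of_nonneg hN.le]
      gcongr
    have t3 : ‖(N ^ 2 : ℂ)⁻¹ * (s0 p * Rvw p)‖ ≤ (N ^ 2)⁻¹ * (S * (K ^ 2 * ‖R p‖)) := by
      rw [norm_mul, norm_mul, norm_inv, norm_pow, Complex.norm_real, Real.norm_of_nonneg hN.le]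
      gcongr
    refine (norm_add₃_le).trans ((add_le_add (add_le_add t1 t2) t3).trans_eq ?_)
    field_simp
    ring

/-! ### The positive kernel -/

theorem norm_trigPoly1_le {m : ℕ} {a : ℤ → ℂ} {C : ℝ} (h : ∀ k : ℤ, |k| ≤ m → ‖a k‖ ≤ C)
    (x : Circ) : ‖trigPoly1 m a x‖ ≤ (2 * m + 1) * C := by
  refine (norm_sum_le_of_le (f := fun k => a k * fourier k x) (n := fun _ => C) _
    fun k hk => ?_).trans_eq ?_
  · rw [norm_mul, fourier_apply, Circle.norm_coe, mul_one]
    exact h k (abs_le.2 (Finset.mem_Icc.1 hk))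
  · simp only [Finset.sum_const, Int.card_Icc, nsmul_eq_mul]
    congr 1
    have : ((m : ℤ) + 1 - -m).toNat = 2 * m + 1 := by omega
    rw [this]; push_cast; ring

theorem fourier_eq_zpow (k : ℤ) (x : Circ) : (fourier k x : ℂ) = (fourier 1 x : ℂ) ^ k := by
  rw [fourier_apply, fourier_one, AddCircle.toCircle_zsmul, Circle.coe_zpow]

theorem sum_Icc_neg_eq_sum_range (m : ℕ) (f : ℤ → ℂ) :
    ∑ k ∈ Finset.Icc (-m : ℤ) m, f k = ∑ i ∈ Finset.range (2 * m + 1), f (i - m) := by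
  refine Finset.sum_nbij' (fun k => (k + m).toNat) (fun i => (i : ℤ) - m) ?_ ?_ ?_ ?_ ?_
  · intro k hk; simp only [Finset.mem_Icc, Finset.mem_range] at *; omega
  · intro k hk; simp only [Finset.mem_Icc, Finset.mem_range] at *; omega
  · intro k hk; simp only [Finset.mem_Icc] at *; omega
  · intro k hk; simp only [Finset.mem_range] at *; omega
  · intro k hk
    simp only [Finset.mem_Icc] at hk
    congr 1
    omega

/-- The binomial kernel `(2 + 2 cos x)^m` expanded into its Fourier series. -/
theorem sum_choose_mul_fourier (m : ℕ) (x : Circ) :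
    ∑ k ∈ Finset.Icc (-m : ℤ) m, ((2 * m).choose (k + m).toNat : ℂ) * fourier k x =
      (((2 + 2 * (fourier 1 x : ℂ).re) ^ m : ℝ) : ℂ) := by
  rw [sum_Icc_neg_eq_sum_range]
  set z : ℂ := fourier 1 x with hz
  have hz1 : ‖z‖ = 1 := by rw [hz, fourier_one]; exact Circle.norm_coe _
  have hz0 : z ≠ 0 := by intro h; rw [h] at hz1; simp at hz1
  have hinv : z⁻¹ = starRingEnd ℂ z := Complex.inv_eq_conj hz1
  -- The sum becomes the binomial expansion of z^{-m} (1 + z)^{2m} = (z + 2 + z^{-1})^m.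
  have h1 : ∀ i ∈ Finset.range (2 * m + 1),
      ((2 * m).choose (((i : ℤ) - m) + m).toNat : ℂ) * fourier ((i : ℤ) - m) x =
      z⁻¹ ^ m * (z ^ i * 1 ^ (2 * m - i) * ((2 * m).choose i : ℂ)) := by
    intro i _
    rw [fourier_eq_zpow, ← hz, zpow_sub₀ hz0, zpow_natCast, zpow_natCast]
    have : ((i : ℤ) - m + m).toNat = i := by omega
    rw [this, inv_pow]
    field_simp
    ring
  rw [Finset.sum_congr rfl h1, ← Finset.mul_sum, ← add_pow, pow_mul, ← mul_pow]
  push_cast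
  congr 1
  have h2 : z + starRingEnd ℂ z = ((2 * z.re : ℝ) : ℂ) := Complex.add_conj z
  push_cast at h2
  rw [← h2, ← hinv]
  field_simp
  ring

/-- A positive trigonometric kernel of degree `m`, bounded below, with mean one and first Fourier
coefficients close to one. -/
theorem exists_kernel (m : ℕ) (hm : 1 ≤ m) : ∃ a : ℤ → ℂ, a 0 = 1 ∧
    a 1 = (((m / (m + 1) : ℝ) ^ 2 : ℝ) : ℂ) ∧ a (-1) = (((m / (m + 1) : ℝ) ^ 2 : ℝ) : ℂ) ∧
    (∀ k, ‖a k‖ ≤ 1) ∧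
    ∀ x, ∃ ρ : ℝ, 1 / (m + 1 : ℝ) ≤ ρ ∧ trigPoly1 m a x = ρ := by
  set c : ℝ := ((2 * m).choose m : ℝ) with hc
  have hcpos : 0 < c := by rw [hc]; exact_mod_cast Nat.choose_pos (by omega)
  have hM : (0 : ℝ) < m + 1 := by positivity
  set b : ℤ → ℝ := fun k => ((2 * m).choose (k + m).toNat : ℝ) / c with hb
  -- A convex combination of the normalized binomial kernel and the constant 1. The mean stays one,
  -- the constant part supplies the lower bound 1/(m+1), and the first coefficients lose only one
  -- further factor m/(m+1).
  set a : ℤ → ℝ := fun k => m / (m + 1) * b k + if k = 0 then 1 / (m + 1 : ℝ) else 0 with ha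
  have hb0 : ∀ k, 0 ≤ b k := fun k => by rw [hb]; positivity
  have hb1 : ∀ k, b k ≤ 1 := fun k => by
    rw [hb]
    refine (div_le_one hcpos).2 ?_
    rw [hc]
    exact_mod_cast Nat.choose_le_centralBinom _ _
  have hb00 : b 0 = 1 := by
    simp only [hb, zero_add, Int.toNat_natCast, ← hc]
    exact div_self hcpos.ne'
  have key : ((2 * m).choose (m + 1) : ℝ) * (m + 1) = c * m := by
    have h := Nat.choose_succ_right_eq (2 * m) m
    rw [show 2 * m - m = m by omega] at h
    rw [hc]; exact_mod_cast h
  have hbp : b 1 = m / (m + 1) := by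
    have : ((1 : ℤ) + m).toNat = m + 1 := by omega
    simp only [hb, this]
    rw [div_eq_div_iff hcpos.ne' hM.ne', key]; ring
  have hbn : b (-1) = m / (m + 1) := by
    have h1 : ((-1 : ℤ) + m).toNat = m - 1 := by omega
    have h2 : (2 * m).choose (m - 1) = (2 * m).choose (m + 1) :=
      Nat.choose_symm_of_eq_add (by omega)
    simp only [hb, h1, h2]
    rw [div_eq_div_iff hcpos.ne' hM.ne', key]; ring
  have hsplit : (m / (m + 1) : ℝ) + 1 / (m + 1) = 1 := by field_simp
  have ha0 : a 0 = 1 := by simp only [ha, hb00, if_true, mul_one, hsplit]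
  refine ⟨fun k => (a k : ℂ), by simp [ha0], ?_, ?_, ?_, ?_⟩
  · simp only [ha, hbp]; norm_num; ring
  · simp only [ha, hbn]; norm_num; ring
  · intro k
    rw [Complex.norm_real, Real.norm_eq_abs, abs_le]
    have h0 : (0 : ℝ) ≤ m / (m + 1) := by positivity
    have h1 : (0 : ℝ) ≤ 1 / (m + 1) := by positivity
    have h2 := mul_nonneg h0 (hb0 k)
    have h3 := mul_le_mul_of_nonneg_left (hb1 k) h0
    simp only [ha]
    split_ifs <;> constructor <;> linarith
  · intro x
    set ρ₀ : ℝ := (2 + 2 * (fourier 1 x : ℂ).re) ^ m with hρ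
    have hpos : 0 ≤ ρ₀ := by
      apply pow_nonneg
      have h1 : ‖(fourier 1 x : ℂ)‖ = 1 := by rw [fourier_one]; exact Circle.norm_coe _
      have := (abs_le.1 ((Complex.abs_re_le_norm (fourier 1 x)).trans_eq h1)).1
      linarith
    refine ⟨m / (m + 1) * (ρ₀ / c) + 1 / (m + 1), ?_, ?_⟩
    · have : 0 ≤ m / (m + 1) * (ρ₀ / c) := by positivity
      linarith
    · have h := sum_choose_mul_fourier m x
      rw [← hρ] at h
      have e : ∀ k : ℤ, (a k : ℂ) * fourier k x =
          ((m / (m + 1) / c : ℝ) : ℂ) * (((2 * m).choose (k + m).toNat : ℂ) * fourier k x) +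
            if k = 0 then ((1 / (m + 1) : ℝ) : ℂ) else 0 := by
        intro k
        by_cases hk : k = 0
        · subst hk
          simp only [ha, hb, if_true, fourier_zero]
          push_cast
          ring
        · simp only [ha, hb, if_neg hk]
          push_cast
          ring
      simp only [trigPoly1]
      rw [Finset.sum_congr rfl fun k _ => e k, Finset.sum_add_distrib, ← Finset.mul_sum, h,
        Finset.sum_ite_eq', if_pos (by simp)]
      push_cast
      ring

/-! ### Riesz products, weights and their correlations -/

/-- The lacunary phases `q^j (x + (-1)^j y)`. -/
noncomputable def phase (q j : ℕ) (p : Torus2) : Circ :=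
  linForm ((q : ℤ) ^ j) ((-1) ^ j * (q : ℤ) ^ j) p

/-- The Riesz product of the kernel with coefficients `a` along the phases. -/
noncomputable def riesz (m : ℕ) (a : ℤ → ℂ) (q j : ℕ) (p : Torus2) : ℂ :=
  ∏ i ∈ Finset.range j, trigPoly1 m a (phase q i p)

/-- The weight `(1 + cos x) / 2`. -/
noncomputable def weight (x : Circ) : ℂ := 1 / 2 + (fourier 1 x + fourier (-1) x) / 4

/-- The product of the weights along the phases. -/
noncomputable def weightProd (q k : ℕ) (p : Torus2) : ℂ :=
  ∏ i ∈ Finset.range k, weight (phase q i p)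

theorem exists_weight_eq (x : Circ) : ∃ t : ℝ, 0 ≤ t ∧ t ≤ 1 ∧ weight x = t := by
  have h1 : ‖(fourier 1 x : ℂ)‖ = 1 := by rw [fourier_one]; exact Circle.norm_coe _
  have h2 := abs_le.1 ((Complex.abs_re_le_norm (fourier 1 x)).trans_eq h1)
  refine ⟨1 / 2 + (fourier 1 x : ℂ).re / 2, by linarith, by linarith, ?_⟩
  have h3 := Complex.add_conj (fourier 1 x : ℂ)
  rw [weight, fourier_neg, h3]
  push_cast
  ring

theorem exists_weightProd_eq (q k : ℕ) (p : Torus2) :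
    ∃ t : ℝ, 0 ≤ t ∧ t ≤ 1 ∧ weightProd q k p = t := by
  choose w h0 h1 hw using exists_weight_eq
  refine ⟨∏ i ∈ Finset.range k, w (phase q i p), Finset.prod_nonneg fun i _ => h0 _,
    Finset.prod_le_one (fun i _ => h0 _) fun i _ => h1 _, ?_⟩
  simp [weightProd, hw]

theorem abs_phase_coeff (q j : ℕ) : |(-1 : ℤ) ^ j * (q : ℤ) ^ j| = (q : ℤ) ^ j := by
  rw [abs_mul, abs_pow, abs_neg, abs_one, one_pow, one_mul, abs_of_nonneg (by positivity)]

theorem kernel_phase_mem (m : ℕ) (a : ℤ → ℂ) (q j : ℕ) :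
    (fun p => trigPoly1 m a (phase q j p)) ∈ trigSpace (m * q ^ j) := by
  apply trigPoly1_linForm_mem
  · rw [abs_of_nonneg (by positivity)]; push_cast; rfl
  · rw [abs_phase_coeff]; push_cast; rfl

theorem weight_phase_mem (q j : ℕ) : (fun p => weight (phase q j p)) ∈ trigSpace (q ^ j) := by
  have h : ∀ k : ℤ, |k| = 1 → (fun p => (fourier k (phase q j p) : ℂ)) ∈ trigSpace (q ^ j) := by
    intro k hk
    have : (fun p => (fourier k (phase q j p) : ℂ)) =
        mono (k * (q : ℤ) ^ j) (k * ((-1) ^ j * (q : ℤ) ^ j)) := by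
      funext p
      exact fourier_linForm _ _ _ p
    rw [this]
    apply mono_mem_trigSpace
    · rw [abs_mul, hk, one_mul, abs_of_nonneg (by positivity)]; push_cast; rfl
    · rw [abs_mul, hk, one_mul, abs_phase_coeff]; push_cast; rfl
  have : (fun p => weight (phase q j p)) = (1 / 2 : ℂ) • (1 : Torus2 → ℂ) +
      (1 / 4 : ℂ) • ((fun p => (fourier 1 (phase q j p) : ℂ)) +
        fun p => (fourier (-1) (phase q j p) : ℂ)) := by
    funext p
    simp only [weight, Pi.add_apply, Pi.smul_apply, smul_eq_mul, Pi.one_apply]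
    ring
  rw [this]
  exact add_mem (Submodule.smul_mem _ _ (one_mem_trigSpace _))
    (Submodule.smul_mem _ _ (add_mem (h 1 (by simp)) (h (-1) (by simp))))

theorem riesz_succ (m : ℕ) (a : ℤ → ℂ) (q j : ℕ) :
    riesz m a q (j + 1) = riesz m a q j * fun p => trigPoly1 m a (phase q j p) := by
  funext p
  simp [riesz, Finset.prod_range_succ]

theorem riesz_zero (m : ℕ) (a : ℤ → ℂ) (q : ℕ) : riesz m a q 0 = 1 := by
  funext p
  simp [riesz]

theorem weightProd_succ (q k : ℕ) :
    weightProd q (k + 1) = weightProd q k * fun p => weight (phase q k p) := by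
  funext p
  simp [weightProd, Finset.prod_range_succ]

theorem weightProd_zero (q : ℕ) : weightProd q 0 = 1 := by
  funext p
  simp [weightProd]

theorem riesz_mem (m : ℕ) (a : ℤ → ℂ) (q j : ℕ) :
    riesz m a q j ∈ trigSpace (m * ∑ i ∈ Finset.range j, q ^ i) := by
  induction j with
  | zero => rw [riesz_zero]; exact one_mem_trigSpace _
  | succ j ih =>
    rw [riesz_succ, Finset.sum_range_succ, mul_add]
    exact mul_mem_trigSpace ih (kernel_phase_mem m a q j)

theorem weightProd_mem (q k : ℕ) :
    weightProd q k ∈ trigSpace (∑ i ∈ Finset.range k, q ^ i) := by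
  induction k with
  | zero => rw [weightProd_zero]; exact one_mem_trigSpace _
  | succ k ih =>
    rw [weightProd_succ, Finset.sum_range_succ]
    exact mul_mem_trigSpace ih (weight_phase_mem q k)

/-- This is the lacunarity condition. With c = m + 1, one kernel and one weight at each of the first
n phases together have degree below the next frequency q^n. -/
theorem mul_geom_lt_pow {c q : ℕ} (h : c + 1 ≤ q) (n : ℕ) :
    c * ∑ i ∈ Finset.range n, q ^ i < q ^ n := by
  induction n with
  | zero => simp
  | succ n ih =>
    rw [Finset.sum_range_succ, mul_add, pow_succ]
    nlinarith [Nat.zero_le (q ^ n)]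

theorem weightProd_mul_riesz_mem {m q : ℕ} (a : ℤ → ℂ) {k j n : ℕ}
    (hk : k ≤ n) (hj : j ≤ n) :
    weightProd q k * riesz m a q j ∈ trigSpace ((m + 1) * ∑ i ∈ Finset.range n, q ^ i) := by
  have h1 := mul_mem_trigSpace (weightProd_mem q k) (riesz_mem m a q j)
  refine trigSpace_mono ?_ h1
  have h2 : ∑ i ∈ Finset.range k, q ^ i ≤ ∑ i ∈ Finset.range n, q ^ i :=
    Finset.sum_le_sum_of_subset (Finset.range_mono hk)
  have h3 : ∑ i ∈ Finset.range j, q ^ i ≤ ∑ i ∈ Finset.range n, q ^ i :=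
    Finset.sum_le_sum_of_subset (Finset.range_mono hj)
  rw [add_mul, one_mul, add_comm]
  gcongr

theorem integral_mul_kernel {m q n d : ℕ} {a : ℤ → ℂ} {g : Torus2 → ℂ} (hg : g ∈ trigSpace d)
    (hd : d < q ^ n) {s : ℤ} (hs : |s| ≤ m) :
    ∫ p, g p * (fourier s (phase q n p) * trigPoly1 m a (phase q n p)) ∂torusHaar =
      a (-s) * ∫ p, g p ∂torusHaar :=
  integral_mul_fourier_mul_trigPoly1 hg hs (by exact_mod_cast hd) a

theorem integrable_of_mem_trigSpace {d : ℕ} {f : Torus2 → ℂ} (hf : f ∈ trigSpace d) :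
    Integrable f torusHaar :=
  integrable_torusHaar_of_continuous (continuous_of_mem_trigSpace hf)

/-- The new kernel oscillates faster than everything it multiplies, so it contributes only its mean,
which is one. -/
theorem integral_mul_riesz_succ {m q : ℕ} {a : ℤ → ℂ} (hq : m + 2 ≤ q) (ha : a 0 = 1)
    {k j : ℕ} (h : k ≤ j) :
    ∫ p, weightProd q k p * riesz m a q (j + 1) p ∂torusHaar =
      ∫ p, weightProd q k p * riesz m a q j p ∂torusHaar := by
  have := integral_mul_kernel (a := a) (m := m) (s := 0)
    (weightProd_mul_riesz_mem (m := m) (q := q) a h le_rfl)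
    (mul_geom_lt_pow hq j) (by simp)
  rw [neg_zero, ha, one_mul] at this
  simp only [riesz_succ, Pi.mul_apply, fourier_zero, one_mul, mul_assoc] at this ⊢
  exact this

theorem integral_weight_mul {q n d : ℕ} {g : Torus2 → ℂ} (hg : g ∈ trigSpace d)
    (hd : d < q ^ n) :
    ∫ p, g p * weight (phase q n p) ∂torusHaar = 1 / 2 * ∫ p, g p ∂torusHaar := by
  have h (s : ℤ) := integral_mul_fourier_linForm hg (A := (q : ℤ) ^ n)
    (B := (-1) ^ n * (q : ℤ) ^ n) (k := s) (by exact_mod_cast hd)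
  have hc (s : ℤ) : Integrable (fun p => g p * fourier s (phase q n p)) torusHaar := by
    apply integrable_torusHaar_of_continuous
    apply (continuous_of_mem_trigSpace hg).mul
    simp only [phase, fourier_linForm]
    exact continuous_mono _ _
  have e : ∀ p, g p * weight (phase q n p) = 1 / 2 * g p + (1 / 4 *
      (g p * fourier 1 (phase q n p)) + 1 / 4 * (g p * fourier (-1) (phase q n p))) := by
    intro p
    rw [weight]
    ring
  have i0 := (integrable_of_mem_trigSpace hg).const_mul (1 / 2 : ℂ)
  have i1 := (hc 1).const_mul (1 / 4 : ℂ)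
  have i2 := (hc (-1)).const_mul (1 / 4 : ℂ)
  have i3 : Integrable (fun p => 1 / 4 * (g p * fourier 1 (phase q n p)) +
      1 / 4 * (g p * fourier (-1) (phase q n p))) torusHaar := i1.add i2
  simp only [e]
  rw [integral_add i0 i3, integral_add i1 i2, integral_const_mul, integral_const_mul,
    integral_const_mul]
  unfold phase
  rw [h, h]
  simp

/-- Here the new weight has no kernel at its own phase, so it contributes only its mean 1/2. -/
theorem integral_weightProd_succ_mul {m q : ℕ} {a : ℤ → ℂ} (hq : m + 2 ≤ q)
    {k j : ℕ} (h : j ≤ k) :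
    ∫ p, weightProd q (k + 1) p * riesz m a q j p ∂torusHaar =
      1 / 2 * ∫ p, weightProd q k p * riesz m a q j p ∂torusHaar := by
  have := integral_weight_mul
    (weightProd_mul_riesz_mem (m := m) (q := q) a le_rfl h)
    (mul_geom_lt_pow hq k)
  simp only [weightProd_succ, Pi.mul_apply] at this ⊢
  rw [← this]
  congr 1
  funext p
  ring

/-- The new weight and the new kernel share a phase and do correlate: the factor is the mean of
their product. It is near 1 when the kernel concentrates near 0, where the weight is near 1. -/
theorem integral_weightProd_mul_riesz_diag {m q : ℕ} {a : ℤ → ℂ} (hq : m + 2 ≤ q) (hm : 1 ≤ m)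
    (ha : a 0 = 1) (j : ℕ) :
    ∫ p, weightProd q (j + 1) p * riesz m a q (j + 1) p ∂torusHaar =
      (1 / 2 + (a 1 + a (-1)) / 4) * ∫ p, weightProd q j p * riesz m a q j p ∂torusHaar := by
  have hg := weightProd_mul_riesz_mem (m := m) (q := q) a (le_refl j) le_rfl
  have h (s : ℤ) (hs : |s| ≤ m) := integral_mul_kernel (a := a) (m := m) (s := s) hg
    (mul_geom_lt_pow hq j) hs
  have hm' : (1 : ℤ) ≤ m := by exact_mod_cast hm
  have h0 := h 0 (by simp)
  have h1 := h 1 (by simpa using hm')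
  have h2 := h (-1) (by simpa using hm')
  rw [neg_zero, ha] at h0
  rw [neg_neg] at h2
  have hi (s : ℤ) : Integrable (fun p => (weightProd q j * riesz m a q j) p *
      (fourier s (phase q j p) * trigPoly1 m a (phase q j p))) torusHaar := by
    apply integrable_torusHaar_of_continuous
    refine (continuous_of_mem_trigSpace hg).mul
      (Continuous.mul ?_ (continuous_of_mem_trigSpace (kernel_phase_mem m a q j)))
    simp only [phase, fourier_linForm]
    exact continuous_mono _ _
  have e : ∀ p, weightProd q (j + 1) p * riesz m a q (j + 1) p =
      1 / 2 * ((weightProd q j * riesz m a q j) p *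
        (fourier 0 (phase q j p) * trigPoly1 m a (phase q j p))) +
      (1 / 4 * ((weightProd q j * riesz m a q j) p *
        (fourier 1 (phase q j p) * trigPoly1 m a (phase q j p))) +
      1 / 4 * ((weightProd q j * riesz m a q j) p *
        (fourier (-1) (phase q j p) * trigPoly1 m a (phase q j p)))) := by
    intro p
    simp only [weightProd_succ, riesz_succ, Pi.mul_apply, weight, fourier_zero]
    ring
  have i0 := (hi 0).const_mul (1 / 2 : ℂ)
  have i1 := (hi 1).const_mul (1 / 4 : ℂ)
  have i2 := (hi (-1)).const_mul (1 / 4 : ℂ)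
  have i3 : Integrable (fun p => 1 / 4 * ((weightProd q j * riesz m a q j) p *
        (fourier 1 (phase q j p) * trigPoly1 m a (phase q j p))) +
      1 / 4 * ((weightProd q j * riesz m a q j) p *
        (fourier (-1) (phase q j p) * trigPoly1 m a (phase q j p)))) torusHaar := i1.add i2
  simp only [e]
  rw [integral_add i0 i3, integral_add i1 i2, integral_const_mul, integral_const_mul,
    integral_const_mul, h0, h1, h2]
  simp only [Pi.mul_apply]
  ring

theorem integral_weightProd_mul_riesz {m q : ℕ} {a : ℤ → ℂ} (hq : m + 2 ≤ q) (hm : 1 ≤ m)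
    (ha : a 0 = 1) {α : ℝ} (hα : 1 / 2 + (a 1 + a (-1)) / 4 = α) (k j : ℕ) :
    ∫ p, weightProd q k p * riesz m a q j p ∂torusHaar =
      ((α ^ min k j * (1 / 2) ^ (k - j) : ℝ) : ℂ) := by
  have hd : ∀ j, ∫ p, weightProd q j p * riesz m a q j p ∂torusHaar = ((α ^ j : ℝ) : ℂ) := by
    intro j
    induction j with
    | zero => simp [weightProd_zero, riesz_zero]
    | succ j ih =>
      rw [integral_weightProd_mul_riesz_diag hq hm ha, ih, hα, pow_succ']
      push_cast
      ring
  rcases le_total k j with h | h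
  · obtain ⟨t, rfl⟩ := Nat.exists_eq_add_of_le h
    rw [min_eq_left h, Nat.sub_eq_zero_of_le h, pow_zero, mul_one]
    clear h
    induction t with
    | zero => exact hd k
    | succ t ih => rw [← add_assoc, integral_mul_riesz_succ hq ha (by omega), ih]
  · obtain ⟨t, rfl⟩ := Nat.exists_eq_add_of_le h
    rw [min_eq_right h, Nat.add_sub_cancel_left]
    clear h
    induction t with
    | zero => simpa using hd j
    | succ t ih =>
      rw [← add_assoc, integral_weightProd_succ_mul hq (by omega), ih, pow_succ]
      push_cast
      ring

theorem integral_riesz {m q : ℕ} {a : ℤ → ℂ} (hq : m + 2 ≤ q) (hm : 1 ≤ m)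
    (ha : a 0 = 1) {α : ℝ} (hα : 1 / 2 + (a 1 + a (-1)) / 4 = α) (j : ℕ) :
    ∫ p, riesz m a q j p ∂torusHaar = 1 := by
  simpa [weightProd_zero] using integral_weightProd_mul_riesz hq hm ha hα 0 j

/-! ### The test function and its pairing with the increments -/

/-- The bounded test function detecting the oscillation of the Riesz products. -/
noncomputable def testFun (q n : ℕ) (p : Torus2) : ℂ :=
  ∑ k ∈ Finset.range n, (-1) ^ k * (weightProd q k p - weightProd q (k + 1) p)

/-- At each point the weight products decrease in k and lie in [0, 1], so the absolute values of the
differences telescope to at most 1. -/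
theorem norm_testFun_le (q n : ℕ) (p : Torus2) : ‖testFun q n p‖ ≤ 1 := by
  choose t h0 h1 ht using fun k => exists_weightProd_eq q k p
  have hmono : ∀ k, t (k + 1) ≤ t k := by
    intro k
    obtain ⟨w, w0, w1, hw⟩ := exists_weight_eq (phase q k p)
    have h := ht (k + 1)
    rw [weightProd_succ, Pi.mul_apply, ht k, hw] at h
    have h' : t k * w = t (k + 1) := by exact_mod_cast h
    rw [← h']
    exact mul_le_of_le_one_right (h0 k) w1
  have hb : ‖testFun q n p‖ ≤ ∑ k ∈ Finset.range n, (t k - t (k + 1)) := by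
    refine norm_sum_le_of_le _ fun k _ => ?_
    rw [norm_mul, norm_pow, norm_neg, norm_one, one_pow, one_mul, ht, ht, ← Complex.ofReal_sub,
      Complex.norm_real, Real.norm_of_nonneg (sub_nonneg.2 (hmono k))]
  rw [Finset.sum_range_sub'] at hb
  linarith [h0 n, h1 0]

/-- Terms with k < j vanish, since both Riesz products see the same weights. The term k = j gives
-(-1)^j α^j (α - 1/2), and the later ones add (-1)^k α^j (α - 1/2) 2^{-(k-j)}, a geometric series of
ratio -1/2 that reinforces the main term. -/
theorem alternating_sum_eq (α : ℝ) (j t : ℕ) :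
    ∑ k ∈ Finset.range (j + 1 + t), (-1 : ℝ) ^ k *
      ((α ^ min k (j + 1) * (1 / 2) ^ (k - (j + 1)) -
        α ^ min (k + 1) (j + 1) * (1 / 2) ^ (k + 1 - (j + 1))) -
      (α ^ min k j * (1 / 2) ^ (k - j) - α ^ min (k + 1) j * (1 / 2) ^ (k + 1 - j))) =
    -(-1) ^ j * (α ^ j * (α - 1 / 2)) * (1 + (1 - (-1 / 2) ^ t) / 3) := by
  induction t with
  | zero =>
    rw [add_zero, Finset.sum_range_succ, Finset.sum_eq_zero]
    · rw [min_eq_left (Nat.le_succ j), min_self, min_self, min_eq_right (Nat.le_succ j),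
        Nat.sub_eq_zero_of_le (Nat.le_succ j), Nat.sub_self, Nat.sub_self, Nat.add_sub_cancel_left]
      ring
    · intro k hk
      have hk := Finset.mem_range.1 hk
      rw [min_eq_left (by omega), min_eq_left (by omega), min_eq_left (by omega),
        min_eq_left (by omega), Nat.sub_eq_zero_of_le (by omega), Nat.sub_eq_zero_of_le (by omega),
        Nat.sub_eq_zero_of_le (by omega), Nat.sub_eq_zero_of_le (by omega)]
      ring
  | succ t ih =>
    rw [← add_assoc, Finset.sum_range_succ, ih, min_eq_right (by omega), min_eq_right (by omega),
      min_eq_right (by omega), min_eq_right (by omega),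
      show j + 1 + t - (j + 1) = t by omega, show j + 1 + t + 1 - (j + 1) = t + 1 by omega,
      show j + 1 + t - j = t + 1 by omega, show j + 1 + t + 1 - j = t + 2 by omega]
    have : (-1 / 2 : ℝ) ^ t = (-1) ^ t * (1 / 2) ^ t := by rw [← mul_pow]; norm_num
    rw [pow_succ (-1 / 2 : ℝ), this]
    ring

theorem integral_testFun_mul {m q : ℕ} {a : ℤ → ℂ} (hq : m + 2 ≤ q) (hm : 1 ≤ m)
    (ha : a 0 = 1) {α : ℝ} (hα : 1 / 2 + (a 1 + a (-1)) / 4 = α) (j t : ℕ) :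
    ∫ p, testFun q (j + 1 + t) p * (riesz m a q (j + 1) p - riesz m a q j p) ∂torusHaar =
      ((-(-1) ^ j * (α ^ j * (α - 1 / 2)) * (1 + (1 - (-1 / 2) ^ t) / 3) : ℝ) : ℂ) := by
  have hi : ∀ k j, Integrable (fun p => weightProd q k p * riesz m a q j p) torusHaar :=
    fun k j => integrable_of_mem_trigSpace
      (mul_mem_trigSpace (weightProd_mem q k) (riesz_mem m a q j))
  rw [← alternating_sum_eq]
  have e : ∀ p, testFun q (j + 1 + t) p * (riesz m a q (j + 1) p - riesz m a q j p) =
      ∑ k ∈ Finset.range (j + 1 + t), (-1 : ℂ) ^ k *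
        ((weightProd q k p * riesz m a q (j + 1) p -
          weightProd q (k + 1) p * riesz m a q (j + 1) p) -
        (weightProd q k p * riesz m a q j p - weightProd q (k + 1) p * riesz m a q j p)) := by
    intro p
    rw [testFun, Finset.sum_mul]
    exact Finset.sum_congr rfl fun k _ => by ring
  simp only [e]
  have hs : ∀ k j, Integrable (fun p => weightProd q k p * riesz m a q j p -
      weightProd q (k + 1) p * riesz m a q j p) torusHaar :=
    fun k j => (hi k j).sub (hi (k + 1) j)
  have hd : ∀ k, Integrable (fun p => (-1 : ℂ) ^ k *
        ((weightProd q k p * riesz m a q (j + 1) p -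
          weightProd q (k + 1) p * riesz m a q (j + 1) p) -
        (weightProd q k p * riesz m a q j p - weightProd q (k + 1) p * riesz m a q j p)))
      torusHaar := fun k => ((hs k (j + 1)).sub (hs k j)).const_mul _
  rw [integral_finsetSum _ fun k _ => hd k]
  rw [Complex.ofReal_sum]
  refine Finset.sum_congr rfl fun k _ => ?_
  rw [integral_const_mul, integral_sub (hs k (j + 1)) (hs k j), integral_sub (hi _ _) (hi _ _),
    integral_sub (hi _ _) (hi _ _)]
  simp only [integral_weightProd_mul_riesz hq hm ha hα]
  push_cast
  ring

/-! ### Second derivatives of the potential -/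

theorem HasDir.unique {v : ℤ × ℤ} {f g h : Torus2 → ℂ} (hg : HasDir v f g) (hh : HasDir v f h) :
    g = h := funext fun p => (hg p).unique (hh p)

theorem exists_hasDir_of_mem_trigSpace (v : ℤ × ℤ) {d : ℕ} {f : Torus2 → ℂ}
    (hf : f ∈ trigSpace d) : ∃ g ∈ trigSpace d, HasDir v f g := by
  induction hf using Submodule.span_induction with
  | zero => exact ⟨0, zero_mem _, fun p => hasDerivAt_const _ _⟩
  | add a b _ _ ha hb =>
    obtain ⟨a', h1, h2⟩ := ha
    obtain ⟨b', h3, h4⟩ := hb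
    exact ⟨a' + b', add_mem h1 h3, h2.add h4⟩
  | smul c a _ ha =>
    obtain ⟨a', h1, h2⟩ := ha
    exact ⟨c • a', Submodule.smul_mem _ _ h1, h2.smul c⟩
  | mem a ha =>
    obtain ⟨k, l, hk, hl, rfl⟩ := ha
    refine ⟨_, ?_, hasDir_mono v k l⟩
    exact Submodule.smul_mem _ (((k * v.1 + l * v.2 : ℤ) : ℂ) * Complex.I)
      (mono_mem_trigSpace hk hl)

/-- Differentiation multiplies each monomial by a scalar, and derivatives are unique. Hence a
derivative found only as main term plus error is still a polynomial, and in particular integrable.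
-/
theorem HasDir2.mem_trigSpace {v w : ℤ × ℤ} {d : ℕ} {f g : Torus2 → ℂ} (hf : f ∈ trigSpace d)
    (h : HasDir2 v w f g) : g ∈ trigSpace d := by
  obtain ⟨f', h1, h2⟩ := h
  obtain ⟨a, a1, a2⟩ := exists_hasDir_of_mem_trigSpace w hf
  rw [h1.unique a2] at h2
  obtain ⟨b, b1, b2⟩ := exists_hasDir_of_mem_trigSpace v a1
  rwa [h2.unique b2]

/-- The derivative of the `i`-th phase in the direction `v`, divided by its frequency. -/
def dirSign (v : ℤ × ℤ) (i : ℕ) : ℤ := v.1 + (-1) ^ i * v.2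

theorem phase_derivative (v : ℤ × ℤ) (q i : ℕ) :
    (((q : ℤ) ^ i * v.1 + (-1) ^ i * (q : ℤ) ^ i * v.2 : ℤ) : ℂ) =
      dirSign v i * (((q : ℝ) ^ i : ℝ) : ℂ) := by
  simp only [dirSign]
  push_cast
  ring

/-- The lower bound 1/(m+1) on the kernel turns absolute bounds for its derivatives into bounds
relative to the kernel, at the cost of a factor m + 1. -/
theorem tame_kernel_phase {v w : ℤ × ℤ} {m : ℕ} {a : ℤ → ℂ} (hm : 1 ≤ m)
    (ha1 : ∀ k, ‖a k‖ ≤ 1)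
    (har : ∀ x, ∃ ρ : ℝ, 1 / (m + 1 : ℝ) ≤ ρ ∧ trigPoly1 m a x = ρ) (q i : ℕ)
    (hv : |dirSign v i| ≤ 1) (hw : |dirSign w i| ≤ 1) :
    Tame v w (fun p => trigPoly1 m a (phase q i p))
      ((2 * m + 1) * m * (m + 1) * (q : ℝ) ^ i) := by
  have d0 := hasDir_trigPoly1_linForm v m a ((q : ℤ) ^ i) ((-1) ^ i * (q : ℤ) ^ i)
  have d1 := hasDir_trigPoly1_linForm w m a ((q : ℤ) ^ i) ((-1) ^ i * (q : ℤ) ^ i)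
  have d2 := (hasDir_trigPoly1_linForm v m (fun k => k * Complex.I * a k) ((q : ℤ) ^ i)
    ((-1) ^ i * (q : ℤ) ^ i)).smul (dirSign w i * (((q : ℝ) ^ i : ℝ) : ℂ))
  rw [phase_derivative] at d0 d1 d2
  refine ⟨_, _, _, d0, d1, d2, fun p => ?_⟩
  have hv' : ‖(dirSign v i : ℂ)‖ ≤ 1 := by rw [Complex.norm_intCast]; exact_mod_cast hv
  have hw' : ‖(dirSign w i : ℂ)‖ ≤ 1 := by rw [Complex.norm_intCast]; exact_mod_cast hw
  have hq : ‖(((q : ℝ) ^ i : ℝ) : ℂ)‖ = (q : ℝ) ^ i := by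
    rw [Complex.norm_real, Real.norm_of_nonneg (by positivity)]
  have hk : ∀ k : ℤ, |k| ≤ m → ‖(k : ℂ)‖ ≤ m := by
    intro k hk
    rw [Complex.norm_intCast]
    exact_mod_cast hk
  have b1 : ∀ x, ‖trigPoly1 m (fun k => k * Complex.I * a k) x‖ ≤ (2 * m + 1) * m := by
    refine norm_trigPoly1_le fun k h => ?_
    rw [norm_mul, norm_mul, Complex.norm_I, mul_one]
    have := mul_le_mul (hk k h) (ha1 k) (norm_nonneg _) (by positivity)
    linarith
  have b2 : ∀ x, ‖trigPoly1 m (fun k => k * Complex.I * (k * Complex.I * a k)) x‖ ≤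
      (2 * m + 1) * (m * m) := by
    refine norm_trigPoly1_le fun k h => ?_
    rw [norm_mul, norm_mul, norm_mul, norm_mul, Complex.norm_I, mul_one]
    have := mul_le_mul (hk k h) (ha1 k) (norm_nonneg _) (by positivity)
    have := mul_le_mul (hk k h) this (by positivity) (by positivity)
    linarith
  have hm1 : (1 : ℝ) ≤ m := by exact_mod_cast hm
  have hr : 1 ≤ (m + 1) * ‖trigPoly1 m a (phase q i p)‖ := by
    obtain ⟨ρ, h1, h2⟩ := har (phase q i p)
    have : 0 < 1 / (m + 1 : ℝ) := by positivity
    rw [h2, Complex.norm_real, Real.norm_of_nonneg (by linarith)]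
    rw [div_le_iff₀ (by positivity)] at h1
    linarith
  set r := ‖trigPoly1 m a (phase q i p)‖ with hrdef
  have hr0 : 0 ≤ r := norm_nonneg _
  have c1 : (2 * m + 1) * m ≤ (2 * m + 1) * m * ((m + 1) * r) :=
    le_mul_of_one_le_right (by positivity) hr
  have t1 : ∀ σ : ℂ, ‖σ‖ ≤ 1 → ∀ x, ‖σ * (((q : ℝ) ^ i : ℝ) : ℂ) *
      trigPoly1 m (fun k => k * Complex.I * a k) x‖ ≤
      (2 * m + 1) * m * (m + 1) * (q : ℝ) ^ i * r := by
    intro σ hσ x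
    rw [norm_mul, norm_mul, hq]
    calc _ ≤ 1 * (q : ℝ) ^ i * ((2 * m + 1) * m * ((m + 1) * r)) := by
            gcongr
            exact (b1 x).trans c1
      _ = _ := by ring
  refine ⟨t1 _ hv' _, t1 _ hw' _, ?_⟩
  simp only [Pi.smul_apply, smul_eq_mul]
  rw [norm_mul, norm_mul, norm_mul, norm_mul, hq]
  -- The surplus factors 2m + 1 and m + 1 only serve to make the right side fit the square of the
  -- first-order rate.
  have c2 : ((2 * m + 1) * (m * m) : ℝ) ≤
      ((2 * m + 1) * (2 * m + 1) * (m * m)) * (m + 1) * ((m + 1) * r) := by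
    have e1 : ((2 * m + 1) * (m * m) : ℝ) ≤ (2 * m + 1) * (2 * m + 1) * (m * m) := by
      gcongr
      nlinarith
    have e2 : ((2 * m + 1) * (2 * m + 1) * (m * m) : ℝ) ≤
        (2 * m + 1) * (2 * m + 1) * (m * m) * (m + 1) :=
      le_mul_of_one_le_right (by positivity) (by linarith)
    exact e1.trans (e2.trans (le_mul_of_one_le_right (by positivity) hr))
  calc _ ≤ 1 * (q : ℝ) ^ i * (1 * (q : ℝ) ^ i *
        (((2 * m + 1) * (2 * m + 1) * (m * m)) * (m + 1) * ((m + 1) * r))) := by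
          gcongr
          exact (b2 _).trans c2
    _ = _ := by ring

theorem tame_riesz {v w : ℤ × ℤ} {m : ℕ} {a : ℤ → ℂ} (hm : 1 ≤ m)
    (ha1 : ∀ k, ‖a k‖ ≤ 1)
    (har : ∀ x, ∃ ρ : ℝ, 1 / (m + 1 : ℝ) ≤ ρ ∧ trigPoly1 m a x = ρ) (q : ℕ)
    (hv : ∀ i, |dirSign v i| ≤ 1) (hw : ∀ i, |dirSign w i| ≤ 1) (j : ℕ) :
    Tame v w (riesz m a q j)
      ((2 * m + 1) * m * (m + 1) * ∑ i ∈ Finset.range j, (q : ℝ) ^ i) := by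
  induction j with
  | zero => rw [riesz_zero]; simpa using tame_one v w
  | succ j ih =>
    rw [riesz_succ, Finset.sum_range_succ, mul_add]
    exact ih.mul (tame_kernel_phase hm ha1 har q j (hv j) (hw j))

/-- Coefficients of the second antiderivative of the kernel minus its mean. -/
noncomputable def antiCoeff (a : ℤ → ℂ) (k : ℤ) : ℂ := if k = 0 then 0 else -a k / k ^ 2

theorem norm_antiCoeff_le {a : ℤ → ℂ} (ha1 : ∀ k, ‖a k‖ ≤ 1) (k : ℤ) :
    ‖antiCoeff a k‖ ≤ 1 ∧ ‖(k : ℂ) * Complex.I * antiCoeff a k‖ ≤ 1 := by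
  by_cases hk : k = 0
  · simp [antiCoeff, hk]
  · have h1 : (1 : ℝ) ≤ ‖(k : ℂ)‖ := by
      rw [Complex.norm_intCast]
      exact_mod_cast Int.one_le_abs hk
    have h0 : 0 < ‖(k : ℂ)‖ := by linarith
    have h2 := ha1 k
    simp only [antiCoeff, if_neg hk]
    constructor
    · rw [norm_div, norm_neg, norm_pow, div_le_one (by positivity)]
      nlinarith
    · rw [norm_mul, norm_mul, Complex.norm_I, mul_one, norm_div, norm_neg, norm_pow,
        mul_div_assoc', div_le_one (by positivity)]
      nlinarith

theorem trigPoly1_antiCoeff (m : ℕ) {a : ℤ → ℂ} (ha : a 0 = 1) (x : Circ) :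
    trigPoly1 m (fun k => k * Complex.I * (k * Complex.I * antiCoeff a k)) x =
      trigPoly1 m a x - 1 := by
  have e : ∀ k : ℤ, k * Complex.I * (k * Complex.I * antiCoeff a k) * fourier k x =
      a k * fourier k x - if k = 0 then 1 else 0 := by
    intro k
    by_cases hk : k = 0
    · subst hk
      rw [ha, fourier_zero]
      simp [antiCoeff]
    · have : (k : ℂ) ≠ 0 := by exact_mod_cast hk
      simp only [antiCoeff, if_neg hk, sub_zero]
      field_simp
      rw [Complex.I_sq]
      ring
  simp only [trigPoly1]
  rw [Finset.sum_congr rfl fun k _ => e k, Finset.sum_sub_distrib, Finset.sum_ite_eq',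
    if_pos (by simp)]

/-- The lacunary sum whose second derivatives are close to transforms of the Riesz product. -/
noncomputable def potential (m : ℕ) (a : ℤ → ℂ) (q n : ℕ) : Torus2 → ℂ :=
  ∑ j ∈ Finset.range n, (((((q : ℝ) ^ j : ℝ) : ℂ)) ^ 2)⁻¹ •
    ((fun p => trigPoly1 m (antiCoeff a) (phase q j p)) * riesz m a q j)

theorem potential_mem (m : ℕ) (a : ℤ → ℂ) (q n : ℕ) :
    potential m a q n ∈ trigSpace (m * ∑ i ∈ Finset.range n, q ^ i) := by
  refine Submodule.sum_mem _ fun j hj => Submodule.smul_mem _ _ ?_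
  refine trigSpace_mono ?_
    (mul_mem_trigSpace (kernel_phase_mem m (antiCoeff a) q j) (riesz_mem m a q j))
  rw [← mul_add, add_comm, ← Finset.sum_range_succ]
  gcongr
  exact Finset.mem_range.1 hj

/-- The main term of the j-th piece is (K - 1) at the j-th phase times the j-th Riesz product, which
is exactly the next increment. The bound `κ` dominates, for all j at once, the ratio of the rate of
the Riesz product to the frequency q^j. -/
theorem exists_hasDir2_potential {v w : ℤ × ℤ} {m : ℕ} {a : ℤ → ℂ} (hm : 1 ≤ m)
    (ha : a 0 = 1) (ha1 : ∀ k, ‖a k‖ ≤ 1)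
    (har : ∀ x, ∃ ρ : ℝ, 1 / (m + 1 : ℝ) ≤ ρ ∧ trigPoly1 m a x = ρ) {q : ℕ} (hq : 2 ≤ q)
    (hv : ∀ i, |dirSign v i| ≤ 1) (hw : ∀ i, |dirSign w i| ≤ 1) (n : ℕ) {κ : ℝ}
    (hκ : (2 * m + 1) * m * (m + 1) / (q - 1 : ℝ) ≤ κ) :
    ∃ g, HasDir2 v w (potential m a q n) g ∧ ∀ p,
      ‖g p - ∑ j ∈ Finset.range n, ((dirSign v j * dirSign w j : ℤ) : ℂ) *
        (riesz m a q (j + 1) p - riesz m a q j p)‖ ≤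
      (2 * m + 1) * (2 * κ + κ ^ 2) * ∑ j ∈ Finset.range n, ‖riesz m a q j p‖ := by
  have hq' : (2 : ℝ) ≤ q := by exact_mod_cast hq
  have hq0 : (0 : ℝ) < q := by linarith
  have hs : ∀ x, ‖trigPoly1 m (antiCoeff a) x‖ ≤ 2 * m + 1 := fun x => by
    simpa using norm_trigPoly1_le (fun k _ => (norm_antiCoeff_le ha1 k).1) x
  have hs' : ∀ x, ‖trigPoly1 m (fun k => k * Complex.I * antiCoeff a k) x‖ ≤ 2 * m + 1 :=
    fun x => by simpa using norm_trigPoly1_le (fun k _ => (norm_antiCoeff_le ha1 k).2) x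
  have piece := fun j => exists_hasDir2_piece (N := (q : ℝ) ^ j) (m := m) (s := antiCoeff a)
    (by positivity) (by positivity) (phase_derivative v q j) (phase_derivative w q j) (hv j) (hw j)
    hs hs' (tame_riesz hm ha1 har q hv hw j)
  choose E hE hE' using piece
  refine ⟨_, HasDir2.sum fun j _ => hE j, fun p => ?_⟩
  have hκ0 : 0 ≤ κ := le_trans (by apply div_nonneg <;> [positivity; linarith]) hκ
  rw [Finset.sum_apply, ← Finset.sum_sub_distrib, Finset.mul_sum]
  refine norm_sum_le_of_le _ fun j _ => ?_
  have hEj := hE' j p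
  -- The geometric sum is (q^j - 1)/(q - 1), so dividing by q^j leaves at most 1/(q - 1).
  have hκj : (2 * m + 1) * m * (m + 1) * (∑ i ∈ Finset.range j, (q : ℝ) ^ i) / (q : ℝ) ^ j ≤ κ := by
    refine le_trans ?_ hκ
    rw [div_le_div_iff₀ (by positivity) (by linarith), mul_assoc]
    gcongr
    rw [geom_sum_mul]
    linarith
  have h0 : 0 ≤ (2 * m + 1) * m * (m + 1) * (∑ i ∈ Finset.range j, (q : ℝ) ^ i) / (q : ℝ) ^ j := by
    positivity
  have heq : ∀ z : ℂ, z + E j p - z = E j p := fun z => by ring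
  have e2 : riesz m a q (j + 1) p - riesz m a q j p =
      trigPoly1 m (fun k => k * Complex.I * (k * Complex.I * antiCoeff a k)) (phase q j p) *
        riesz m a q j p := by
    rw [trigPoly1_antiCoeff m ha, riesz_succ, Pi.mul_apply]
    ring
  rw [e2]
  simp only [Pi.add_apply, Pi.smul_apply, Pi.mul_apply, smul_eq_mul]
  refine (le_of_eq ?_).trans (hEj.trans ?_)
  · congr 1
    exact heq _
  · gcongr

/-! ### Norm estimates for the pure and mixed derivatives -/

theorem integral_norm_riesz {m q : ℕ} {a : ℤ → ℂ} (hq : m + 2 ≤ q) (hm : 1 ≤ m)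
    (ha : a 0 = 1) {α : ℝ} (hα : 1 / 2 + (a 1 + a (-1)) / 4 = α)
    (har : ∀ x, ∃ ρ : ℝ, 0 ≤ ρ ∧ trigPoly1 m a x = ρ) (j : ℕ) :
    ∫ p, ‖riesz m a q j p‖ ∂torusHaar = 1 := by
  choose r h0 hr using har
  have e : ∀ p, ((‖riesz m a q j p‖ : ℝ) : ℂ) = riesz m a q j p := by
    intro p
    have : riesz m a q j p = ((∏ i ∈ Finset.range j, r (phase q i p) : ℝ) : ℂ) := by
      simp [riesz, hr]
    rw [this, Complex.norm_real, Real.norm_of_nonneg (Finset.prod_nonneg fun i _ => h0 _)]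
  have h := (integral_congr_ae (Filter.Eventually.of_forall e)).trans
    (integral_riesz hq hm ha hα j)
  rw [integral_complex_ofReal] at h
  exact_mod_cast h

theorem dirSign_fst (i : ℕ) : dirSign (1, 0) i = 1 := by simp [dirSign]

theorem dirSign_snd (i : ℕ) : dirSign (0, 1) i = (-1) ^ i := by simp [dirSign]

theorem abs_dirSign_fst_le (i : ℕ) : |dirSign (1, 0) i| ≤ 1 := by simp [dirSign_fst]

theorem abs_dirSign_snd_le (i : ℕ) : |dirSign (0, 1) i| ≤ 1 := by simp [dirSign_snd]

/-- The pure case: the Riesz product telescopes and its `L₁` norm stays bounded. -/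
theorem integral_norm_le_of_near_telescope {m q n : ℕ} (hn : 1 ≤ n) {a : ℤ → ℂ}
    (hi : ∀ j, ∫ p, ‖riesz m a q j p‖ ∂torusHaar = 1) {d : ℕ} {g : Torus2 → ℂ}
    (hg : g ∈ trigSpace d)
    (h : ∀ p, ‖g p - ∑ j ∈ Finset.range n, (riesz m a q (j + 1) p - riesz m a q j p)‖ ≤
      1 / n * ∑ j ∈ Finset.range n, ‖riesz m a q j p‖) :
    ∫ p, ‖g p‖ ∂torusHaar ≤ 3 := by
  have hI : ∀ j, Integrable (fun p => ‖riesz m a q j p‖) torusHaar :=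
    fun j => (integrable_of_mem_trigSpace (riesz_mem m a q j)).norm
  have hS : Integrable (fun p => 1 / (n : ℝ) * ∑ j ∈ Finset.range n, ‖riesz m a q j p‖)
      torusHaar := (integrable_finsetSum _ fun j _ => hI j).const_mul _
  have h1 : Integrable (fun p => ‖riesz m a q n p‖ + 1) torusHaar :=
    (hI n).add (integrable_const _)
  calc ∫ p, ‖g p‖ ∂torusHaar
      ≤ ∫ p, ((‖riesz m a q n p‖ + 1) +
          1 / (n : ℝ) * ∑ j ∈ Finset.range n, ‖riesz m a q j p‖) ∂torusHaar := by
        refine MeasureTheory.integral_mono (integrable_of_mem_trigSpace hg).norm (h1.add hS)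
          fun p => ?_
        have := h p
        rw [Finset.sum_range_sub (fun j => riesz m a q j p), riesz_zero] at this
        have h2 := norm_sub_norm_le (g p) (riesz m a q n p - (1 : Torus2 → ℂ) p)
        have h3 := norm_sub_le (riesz m a q n p) ((1 : Torus2 → ℂ) p)
        rw [Pi.one_apply, norm_one] at h3
        simp only [Pi.one_apply] at *
        linarith
    _ = 3 := by
        rw [integral_add h1 hS, integral_add (hI n) (integrable_const _), integral_const_mul,
          integral_finsetSum _ fun j _ => hI j]
        simp only [hi]
        have : (n : ℝ) ≠ 0 := by positivity
        simp
        field_simp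
        norm_num

/-- The mixed case: the alternating transform of the Riesz product has large `L₁` norm. -/
theorem le_integral_norm_of_near_alternating {m q n : ℕ} (hn : 1 ≤ n) {a : ℤ → ℂ}
    (hq : m + 2 ≤ q) (hm : 1 ≤ m)
    (ha : a 0 = 1) {α c : ℝ} (hα : 1 / 2 + (a 1 + a (-1)) / 4 = α) (hc : 0 ≤ c)
    (hαc : ∀ j < n, c ≤ α ^ j * (α - 1 / 2))
    (hi : ∀ j, ∫ p, ‖riesz m a q j p‖ ∂torusHaar = 1) {d : ℕ} {g : Torus2 → ℂ}
    (hg : g ∈ trigSpace d)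
    (h : ∀ p, ‖g p - ∑ j ∈ Finset.range n,
        (-1) ^ j * (riesz m a q (j + 1) p - riesz m a q j p)‖ ≤
      1 / n * ∑ j ∈ Finset.range n, ‖riesz m a q j p‖) :
    n * c - 1 ≤ ∫ p, ‖g p‖ ∂torusHaar := by
  have hI : ∀ j, Integrable (fun p => ‖riesz m a q j p‖) torusHaar :=
    fun j => (integrable_of_mem_trigSpace (riesz_mem m a q j)).norm
  have hS : Integrable (fun p => 1 / (n : ℝ) * ∑ j ∈ Finset.range n, ‖riesz m a q j p‖)
      torusHaar := (integrable_finsetSum _ fun j _ => hI j).const_mul _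
  have hgI := (integrable_of_mem_trigSpace hg).norm
  have hT : ∀ j, Integrable (fun p => (-1 : ℂ) ^ j *
      (testFun q n p * (riesz m a q (j + 1) p - riesz m a q j p))) torusHaar := by
    intro j
    apply integrable_torusHaar_of_continuous
    refine continuous_const.mul (Continuous.mul ?_
      ((continuous_of_mem_trigSpace (riesz_mem m a q (j + 1))).sub
        (continuous_of_mem_trigSpace (riesz_mem m a q j))))
    exact continuous_finsetSum _ fun k _ => continuous_const.mul
      ((continuous_of_mem_trigSpace (weightProd_mem q k)).sub
        (continuous_of_mem_trigSpace (weightProd_mem q (k + 1))))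
  -- The sign (-1)^j of the increment cancels the one in its pairing with the test function. Every
  -- term thus equals -θ_j with θ_j ≥ c, and the n contributions add up without cancellation.
  choose! θ hθ1 hθ using fun (j : ℕ) (hj : j < n) => show ∃ θ : ℝ, c ≤ θ ∧
      ∫ p, (-1 : ℂ) ^ j * (testFun q n p * (riesz m a q (j + 1) p - riesz m a q j p)) ∂torusHaar =
        ((-θ : ℝ) : ℂ) by
    obtain ⟨t, rfl⟩ := Nat.exists_eq_add_of_le (Nat.succ_le_of_lt hj)
    refine ⟨α ^ j * (α - 1 / 2) * (1 + (1 - (-1 / 2) ^ t) / 3), ?_, ?_⟩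
    · have h1 : |(-1 / 2 : ℝ) ^ t| ≤ 1 := by
        rw [abs_pow]
        exact pow_le_one₀ (abs_nonneg _) (by norm_num [abs_le])
      have h2 := (abs_le.1 h1).2
      have h3 := hαc j hj
      exact h3.trans (le_mul_of_one_le_right (hc.trans h3) (by linarith))
    · rw [integral_const_mul, integral_testFun_mul hq hm ha hα]
      have : ((-1 : ℂ) ^ j) * (-1) ^ j = 1 := by rw [← mul_pow]; norm_num
      push_cast
      linear_combination (-((α : ℂ) ^ j * (α - 1 / 2) * (1 + (1 - (-1 / 2) ^ t) / 3))) * this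
  have hsum : ∫ p, testFun q n p * ∑ j ∈ Finset.range n,
      (-1 : ℂ) ^ j * (riesz m a q (j + 1) p - riesz m a q j p) ∂torusHaar =
      ((-∑ j ∈ Finset.range n, θ j : ℝ) : ℂ) := by
    rw [← Finset.sum_neg_distrib, Complex.ofReal_sum,
      ← Finset.sum_congr rfl fun j hj => hθ j (Finset.mem_range.1 hj),
      ← integral_finsetSum _ fun j _ => hT j]
    congr 1
    funext p
    rw [Finset.mul_sum]
    exact Finset.sum_congr rfl fun j _ => by ring
  have hlow : n * c ≤ ∑ j ∈ Finset.range n, θ j := by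
    have := Finset.card_nsmul_le_sum (Finset.range n) θ c
      fun j hj => hθ1 j (Finset.mem_range.1 hj)
    simpa using this
  have hnorm := norm_integral_le_integral_norm (μ := torusHaar) (fun p => testFun q n p *
    ∑ j ∈ Finset.range n, (-1 : ℂ) ^ j * (riesz m a q (j + 1) p - riesz m a q j p))
  rw [hsum, Complex.norm_real, norm_neg] at hnorm
  have hle := (Real.le_norm_self _).trans hnorm
  have hup : ∫ p, ‖testFun q n p *
      ∑ j ∈ Finset.range n, (-1 : ℂ) ^ j * (riesz m a q (j + 1) p - riesz m a q j p)‖ ∂torusHaar ≤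
      ∫ p, (‖g p‖ + 1 / (n : ℝ) * ∑ j ∈ Finset.range n, ‖riesz m a q j p‖) ∂torusHaar := by
    refine integral_mono_of_nonneg (Filter.Eventually.of_forall fun p => norm_nonneg _)
      (hgI.add hS) (Filter.Eventually.of_forall fun p => ?_)
    have h1 := h p
    rw [norm_sub_rev] at h1
    have h2 := norm_sub_norm_le (∑ j ∈ Finset.range n, (-1 : ℂ) ^ j *
      (riesz m a q (j + 1) p - riesz m a q j p)) (g p)
    have h3 := mul_le_mul_of_nonneg_right (norm_testFun_le q n p)
      (norm_nonneg (∑ j ∈ Finset.range n, (-1 : ℂ) ^ j *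
        (riesz m a q (j + 1) p - riesz m a q j p)))
    simp only [norm_mul] at h3 ⊢
    linarith
  rw [integral_add hgI hS, integral_const_mul, integral_finsetSum _ fun j _ => hI j] at hup
  simp only [hi] at hup
  have hn0 : (n : ℝ) ≠ 0 := by positivity
  have h1n : 1 / (n : ℝ) * ∑ j ∈ Finset.range n, (1 : ℝ) = 1 := by
    simp [hn0]
  rw [h1n] at hup
  linarith

/-- A polynomial of degree less than `(25 (2n + 1)^5)^n` whose pure second derivatives are bounded
in `L₁` while the mixed one has norm of order `n`. -/
theorem exists_bounded_pure_large_mixed (n : ℕ) (hn : 2 ≤ n) :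
    ∃ d < (25 * (2 * n + 1) ^ 5) ^ n, ∃ f ∈ trigSpace d, ∃ gxx ∈ trigSpace d, ∃ gyy ∈ trigSpace d,
      ∃ gxy ∈ trigSpace d, HasDir2 (1, 0) (1, 0) f gxx ∧ HasDir2 (0, 1) (0, 1) f gyy ∧
        HasDir2 (1, 0) (0, 1) f gxy ∧ ∫ p, ‖gxx p‖ ∂torusHaar ≤ 3 ∧
        ∫ p, ‖gyy p‖ ∂torusHaar ≤ 3 ∧ n * (1 / 8 : ℝ) - 1 ≤ ∫ p, ‖gxy p‖ ∂torusHaar := by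
  set M : ℕ := 2 * n + 1 with hM
  have hM5 : 5 ≤ M := by omega
  -- The rate constant is at most 2M³, so dividing by q - 1 = 24 M⁵ gives at most κ = 1/(12 M²). The
  -- factor in front of the error is then at most 2M · 3κ = 1/(2M) ≤ 1/n.
  set q : ℕ := 24 * M ^ 5 + 1 with hq
  -- Degree 2n gives α ≥ 1 - 1/M with M = 2n + 1, so by Bernoulli's inequality α^j ≥ 1 - n/M ≥ 1/2
  -- for all j < n.
  obtain ⟨a, ha0, ha1, ham1, hab, har⟩ := exists_kernel (2 * n) (by omega)
  have hMM : M ≤ M ^ 5 := Nat.le_self_pow (by norm_num) M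
  have hq2 : 2 * n + 2 ≤ q := by omega
  have hqle : q ≤ 25 * M ^ 5 := by omega
  have hmR : ((2 * n : ℕ) : ℝ) + 1 = M := by rw [hM]; push_cast; ring
  have hMR : (5 : ℝ) ≤ M := by exact_mod_cast hM5
  have hnM : (n : ℝ) * 2 + 1 = M := by rw [hM]; push_cast; ring
  have hnR : (2 : ℝ) ≤ n := by exact_mod_cast hn
  have hm1 : 1 ≤ 2 * n := by omega
  have hα : (1 / 2 : ℂ) + (a 1 + a (-1)) / 4 =
      ((1 / 2 + (1 - 1 / M) ^ 2 / 2 : ℝ) : ℂ) := by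
    have : ((2 * n : ℕ) : ℝ) / (((2 * n : ℕ) : ℝ) + 1) = 1 - 1 / M := by
      rw [hmR]
      field_simp
      linarith
    rw [ha1, ham1, this]
    push_cast
    ring
  have hx0 : (0 : ℝ) < 1 / M := by positivity
  have hx1 : (1 / M : ℝ) ≤ 1 / 5 := by gcongr
  have hαc : ∀ j < n, (1 / 8 : ℝ) ≤ (1 / 2 + (1 - 1 / M) ^ 2 / 2) ^ j *
      ((1 / 2 + (1 - 1 / M) ^ 2 / 2 : ℝ) - 1 / 2) := by
    intro j hj
    have h1 : (1 / 2 : ℝ) ≤ (1 / 2 + (1 - 1 / M) ^ 2 / 2) ^ j := by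
      have b := one_add_mul_le_pow (a := -(1 / M : ℝ)) (by linarith) j
      have hj' : (j : ℝ) ≤ n := by exact_mod_cast hj.le
      have c1 : (j : ℝ) * (1 / M) ≤ 1 / 2 := by
        rw [mul_one_div, div_le_iff₀ (by linarith)]
        linarith
      have c2 : (1 + -(1 / M : ℝ)) ^ j ≤ (1 / 2 + (1 - 1 / M) ^ 2 / 2) ^ j := by
        apply pow_le_pow_left₀ (by linarith)
        nlinarith [sq_nonneg (1 / M : ℝ)]
      linarith
    have h2 : (1 / 4 : ℝ) ≤ (1 / 2 + (1 - 1 / M) ^ 2 / 2 : ℝ) - 1 / 2 := by nlinarith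
    calc (1 / 8 : ℝ) = 1 / 2 * (1 / 4) := by norm_num
      _ ≤ _ := by gcongr
  have har' : ∀ x, ∃ ρ : ℝ, 0 ≤ ρ ∧ trigPoly1 (2 * n) a x = ρ := by
    intro x
    obtain ⟨ρ, h1, h2⟩ := har x
    exact ⟨ρ, le_trans (by positivity) h1, h2⟩
  have hi := integral_norm_riesz hq2 hm1 ha0 hα har'
  set κ : ℝ := 1 / (12 * M ^ 2) with hκdef
  have hκ : (2 * ((2 * n : ℕ) : ℝ) + 1) * ((2 * n : ℕ) : ℝ) * (((2 * n : ℕ) : ℝ) + 1) /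
      (q - 1 : ℝ) ≤ κ := by
    have e1 : ((2 * n : ℕ) : ℝ) = M - 1 := by linarith
    have e2 : (q - 1 : ℝ) = 24 * M ^ 5 := by rw [hq]; push_cast; ring
    rw [e1, e2, hκdef, div_le_div_iff₀ (by positivity) (by positivity)]
    have h3 : (2 * (M - 1 : ℝ) + 1) * (M - 1) * (M - 1 + 1) ≤ (2 * M) * M * M := by
      have : (0 : ℝ) ≤ M - 1 := by linarith
      gcongr <;> linarith
    calc _ ≤ (2 * M) * M * M * (12 * M ^ 2 : ℝ) := by gcongr
      _ = _ := by ring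
  have hδ : (2 * ((2 * n : ℕ) : ℝ) + 1) * (2 * κ + κ ^ 2) ≤ 1 / n := by
    have k0 : 0 < κ := by positivity
    have k1 : κ ≤ 1 := by
      rw [hκdef, div_le_one (by positivity)]
      nlinarith
    calc (2 * ((2 * n : ℕ) : ℝ) + 1) * (2 * κ + κ ^ 2) ≤ (2 * M) * (3 * κ) := by
          gcongr
          · linarith
          · nlinarith
      _ = 1 / (2 * M) := by rw [hκdef]; field_simp; norm_num
      _ ≤ 1 / n := by gcongr; linarith
  have hfm := potential_mem (2 * n) a q n
  have main : ∀ v w : ℤ × ℤ, (∀ i, |dirSign v i| ≤ 1) → (∀ i, |dirSign w i| ≤ 1) →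
      ∃ g ∈ trigSpace (2 * n * ∑ i ∈ Finset.range n, q ^ i),
        HasDir2 v w (potential (2 * n) a q n) g ∧ ∀ p,
      ‖g p - ∑ j ∈ Finset.range n, ((dirSign v j * dirSign w j : ℤ) : ℂ) *
        (riesz (2 * n) a q (j + 1) p - riesz (2 * n) a q j p)‖ ≤
      1 / n * ∑ j ∈ Finset.range n, ‖riesz (2 * n) a q j p‖ := by
    intro v w hv hw
    obtain ⟨g, hg1, hg2⟩ := exists_hasDir2_potential hm1 ha0 hab har (by omega) hv hw n hκ
    refine ⟨g, hg1.mem_trigSpace hfm, hg1, fun p => (hg2 p).trans ?_⟩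
    gcongr
  obtain ⟨gxx, x1, x2, x3⟩ := main (1, 0) (1, 0) abs_dirSign_fst_le abs_dirSign_fst_le
  obtain ⟨gyy, y1, y2, y3⟩ := main (0, 1) (0, 1) abs_dirSign_snd_le abs_dirSign_snd_le
  obtain ⟨gxy, z1, z2, z3⟩ := main (1, 0) (0, 1) abs_dirSign_fst_le abs_dirSign_snd_le
  have hsq : ∀ j : ℕ, (-1 : ℤ) ^ j * (-1) ^ j = 1 := fun j => by rw [← mul_pow]; norm_num
  simp only [dirSign_fst, dirSign_snd, one_mul, hsq, Int.cast_one, Int.cast_pow,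
    Int.cast_neg] at x3 y3 z3
  refine ⟨_, ?_, _, hfm, gxx, x1, gyy, y1, gxy, z1, x2, y2, z2,
    integral_norm_le_of_near_telescope (by omega) hi x1 x3,
    integral_norm_le_of_near_telescope (by omega) hi y1 y3,
    le_integral_norm_of_near_alternating (by omega) hq2 hm1 ha0 hα (by norm_num) hαc hi z1 z3⟩
  exact (mul_geom_lt_pow (by omega) n).trans_le (Nat.pow_le_pow_left hqle n)

/-! ### Exact degree, normalization and conclusion -/

theorem normL1_eq_of_mem_trigSpace {d : ℕ} {f : Torus2 → ℂ} (hf : f ∈ trigSpace d) :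
    normL1 f = ENNReal.ofReal (∫ p, ‖f p‖ ∂torusHaar) := by
  rw [normL1, eLpNorm_one_eq_lintegral_enorm,
    ofReal_integral_norm_eq_lintegral_enorm (integrable_of_mem_trigSpace hf)]

theorem norm_mono (k l : ℤ) (p : Torus2) : ‖mono k l p‖ = 1 := by
  rw [mono, norm_mul, fourier_apply, fourier_apply, Circle.norm_coe, Circle.norm_coe, one_mul]

theorem trigDegree_eq_of_coeff {c : TrigPoly2} {N : ℕ} (h : ∀ k l : ℤ, c (k, l) ≠ 0 →
    |k| ≤ N ∧ |l| ≤ N) {k₀ l₀ : ℤ} (h₀ : c (k₀, l₀) ≠ 0) (hk₀ : |k₀| = N) :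
    trigDegree c = N := by
  apply le_antisymm
  · refine Finset.sup_le fun ⟨k, l⟩ hkl => ?_
    have := h k l (Finsupp.mem_support_iff.1 hkl)
    rw [Int.abs_eq_natAbs, Int.abs_eq_natAbs] at this
    exact max_le (by exact_mod_cast this.1) (by exact_mod_cast this.2)
  · have := Finset.le_sup (f := fun k : ℤ × ℤ => max k.1.natAbs k.2.natAbs)
      (Finsupp.mem_support_iff.2 h₀)
    rw [Int.abs_eq_natAbs] at hk₀
    exact (le_of_eq (by exact_mod_cast hk₀.symm)).trans ((le_max_left _ _).trans this)

theorem normL1_smul_add_mono_le {d : ℕ} {g : Torus2 → ℂ} (hg : g ∈ trigSpace d) (k l : ℤ)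
    (z : ℂ) (h : ∫ p, ‖g p‖ ∂torusHaar ≤ 3) :
    normL1 ((1 / 8 : ℂ) • g + z • mono k l) ≤ ENNReal.ofReal (3 / 8 + ‖z‖) := by
  have h1 : (1 / 8 : ℂ) • g + z • mono k l ∈ trigSpace (d + (k.natAbs + l.natAbs)) := by
    refine add_mem (Submodule.smul_mem _ _ (trigSpace_mono (by omega) hg))
      (Submodule.smul_mem _ _ (mono_mem_trigSpace ?_ ?_)) <;>
      exact (Int.abs_eq_natAbs _).trans_le (Int.ofNat_le.2 (by omega))
  rw [normL1_eq_of_mem_trigSpace h1]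
  apply ENNReal.ofReal_le_ofReal
  have hgI := ((integrable_of_mem_trigSpace hg).norm).const_mul (1 / 8 : ℝ)
  calc _ ≤ ∫ p, (1 / 8 * ‖g p‖ + ‖z‖) ∂torusHaar := by
        refine MeasureTheory.integral_mono (integrable_of_mem_trigSpace h1).norm
          (hgI.add (integrable_const _)) fun p => ?_
        simp only [Pi.add_apply, Pi.smul_apply, smul_eq_mul]
        refine (norm_add_le _ _).trans_eq ?_
        rw [norm_mul, norm_mul, norm_mono]
        norm_num
    _ ≤ _ := by
        rw [integral_add hgI (integrable_const _), integral_const_mul]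
        simp
        linarith

/-- A crude bound from 25 ≤ e^{6n} and 2n + 1 ≤ e^{2n}. The true exponent is of order n log n, but a
quadratic one is enough for the square root of the logarithm. -/
theorem pow_lacunary_degree_le_exp (n : ℕ) (hn : 2 ≤ n) :
    (((25 * (2 * n + 1) ^ 5) ^ n : ℕ) : ℝ) ≤ Real.exp (16 * (n : ℝ) ^ 2) := by
  have h3 : (3 : ℝ) ≤ Real.exp 2 := by
    have := Real.add_one_le_exp (2 : ℝ)
    linarith
  have hb : (2 * n + 1 : ℝ) ≤ Real.exp (2 * n) := by
    have := Real.add_one_le_exp (2 * n : ℝ)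
    linarith
  have hn' : (2 : ℝ) ≤ n := by exact_mod_cast hn
  have hc : (25 : ℝ) ≤ Real.exp (6 * n) := by
    calc (25 : ℝ) ≤ 3 ^ 3 := by norm_num
      _ ≤ Real.exp 2 ^ 3 := by gcongr
      _ = Real.exp 6 := by rw [← Real.exp_nat_mul]; norm_num
      _ ≤ _ := Real.exp_le_exp.2 (by linarith)
  push_cast
  calc ((25 : ℝ) * (2 * n + 1) ^ 5) ^ n ≤ (Real.exp (6 * n) * Real.exp (2 * n) ^ 5) ^ n := by
        gcongr
    _ = Real.exp (16 * (n : ℝ) ^ 2) := by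
        rw [← Real.exp_nat_mul, ← Real.exp_add, ← Real.exp_nat_mul]
        congr 1
        push_cast
        ring

/-- A single corner monomial: the mixed derivative is half as large as the pure ones together. -/
theorem exists_trigPoly_trivial (N : ℕ) (hN : 1 ≤ N) : ∃ P : TrigPoly2,
    trigDegree P = N ∧
    normL1 (partialX (partialX (trigFun P))) + normL1 (partialY (partialY (trigFun P))) ≤ 1 ∧
    normL1 (partialX (partialY (trigFun P))) = ENNReal.ofReal (1 / 2) := by
  have hN0 : (N : ℝ) ≠ 0 := by positivity
  set δ : ℝ := 1 / (2 * N ^ 2) with hδ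
  have hδ0 : 0 < δ := by positivity
  have hL (v w : ℤ × ℤ) : HasDir2 v w (trigFun (Finsupp.single ((N : ℤ), (N : ℤ)) (δ : ℂ)))
      ((δ : ℂ) • ((-(((N : ℤ) * v.1 + (N : ℤ) * v.2) * ((N : ℤ) * w.1 + (N : ℤ) * w.2)) : ℂ) •
        mono N N)) := by
    rw [trigFun_single]
    exact (hasDir2_mono v w N N).smul _
  have hnorm : normL1 ((δ : ℂ) • ((-((N : ℂ) * N)) • mono N N)) = ENNReal.ofReal (1 / 2) := by
    have hmem : (δ : ℂ) • ((-((N : ℂ) * N)) • mono N N) ∈ trigSpace N :=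
      Submodule.smul_mem _ _ (Submodule.smul_mem _ _ (mono_mem_trigSpace (by simp) (by simp)))
    rw [normL1_eq_of_mem_trigSpace hmem]
    congr 1
    have : ∀ p, ‖((δ : ℂ) • ((-((N : ℂ) * N)) • mono N N)) p‖ = 1 / 2 := by
      intro p
      simp only [Pi.smul_apply, smul_eq_mul, norm_mul, norm_neg, norm_mono, Complex.norm_real,
        Complex.norm_natCast]
      rw [Real.norm_of_nonneg hδ0.le, hδ]
      field_simp
    simp only [this]
    simp
  refine ⟨Finsupp.single ((N : ℤ), (N : ℤ)) (δ : ℂ), ?_, ?_, ?_⟩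
  · refine trigDegree_eq_of_coeff (fun k l h => ?_) (k₀ := N) (l₀ := N) ?_ (by simp)
    · have h1 : ((N : ℤ), (N : ℤ)) = (k, l) := by
        by_contra h2
        exact h (Finsupp.single_eq_of_ne (Ne.symm h2))
      simp only [Prod.mk.injEq] at h1
      obtain ⟨rfl, rfl⟩ := h1
      simp
    · rw [Finsupp.single_eq_same]
      exact_mod_cast hδ0.ne'
  · have hx := hL (1, 0) (1, 0)
    have hy := hL (0, 1) (0, 1)
    simp only [Int.cast_one, Int.cast_zero, mul_one, mul_zero, add_zero, zero_add,
      Int.cast_natCast] at hx hy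
    rw [hx.partialX_partialX, hy.partialY_partialY, hnorm, ← ENNReal.ofReal_add (by norm_num)
      (by norm_num)]
    norm_num
  · have hxy := hL (1, 0) (0, 1)
    simp only [Int.cast_one, Int.cast_zero, mul_one, mul_zero, add_zero, zero_add,
      Int.cast_natCast] at hxy
    rw [hxy.partialX_partialY, hnorm]

/-- Rescaling and adding a small monomial gives a polynomial of any prescribed larger degree. -/
theorem exists_trigPoly_of_degree {n N : ℕ} (hn : 2 ≤ n)
    (hN : (25 * (2 * n + 1) ^ 5) ^ n ≤ N) : ∃ P : TrigPoly2,
    trigDegree P = N ∧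
    normL1 (partialX (partialX (trigFun P))) + normL1 (partialY (partialY (trigFun P))) ≤ 1 ∧
    ENNReal.ofReal ((n * (1 / 8 : ℝ) - 1) / 8) ≤ normL1 (partialX (partialY (trigFun P))) := by
  obtain ⟨d, hd, f, hf, gxx, x1, gyy, y1, gxy, z1, x2, y2, z2, x3, y3, z3⟩ :=
    exists_bounded_pure_large_mixed n hn
  obtain ⟨c, rfl, hc⟩ := exists_coeff_of_mem_trigSpace hf
  have hdN : d < N := hd.trans_le hN
  have hNpos : 0 < N := by omega
  have hN0 : (N : ℝ) ≠ 0 := by positivity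
  -- The added monomial δ e^{iNx} affects only the xx derivative, by δN² = 1/4, which completes the
  -- budget 3/8 + 3/8 + 1/4 = 1. Since d < N, its coefficient cannot be cancelled.
  set δ : ℝ := 1 / (4 * N ^ 2) with hδ
  have hδ0 : 0 < δ := by positivity
  have hP : trigFun ((1 / 8 : ℂ) • c + Finsupp.single ((N : ℤ), (0 : ℤ)) (δ : ℂ)) =
      (1 / 8 : ℂ) • trigFun c + (δ : ℂ) • mono N 0 := by
    rw [trigFun_add, trigFun_smul, trigFun_single]
  have hD {v w : ℤ × ℤ} {g : Torus2 → ℂ} (h : HasDir2 v w (trigFun c) g) :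
      HasDir2 v w (trigFun ((1 / 8 : ℂ) • c + Finsupp.single ((N : ℤ), (0 : ℤ)) (δ : ℂ)))
      ((1 / 8 : ℂ) • g + ((δ : ℂ) * (-((N : ℂ) * v.1 * (N * w.1)))) • mono N 0) := by
    rw [hP]
    have := (h.smul (1 / 8 : ℂ)).add ((hasDir2_mono v w N 0).smul (δ : ℂ))
    simpa only [smul_smul, Int.cast_zero, zero_mul, add_zero, Int.cast_natCast] using this
  refine ⟨(1 / 8 : ℂ) • c + Finsupp.single ((N : ℤ), (0 : ℤ)) (δ : ℂ), ?_, ?_, ?_⟩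
  · refine trigDegree_eq_of_coeff (fun k l h => ?_) (k₀ := N) (l₀ := 0) ?_ (by simp)
    · by_cases h1 : ((N : ℤ), (0 : ℤ)) = (k, l)
      · simp only [Prod.mk.injEq] at h1
        obtain ⟨rfl, rfl⟩ := h1
        simp
      · have h2 : c (k, l) ≠ 0 := by
          intro h2
          apply h
          rw [Finsupp.add_apply, Finsupp.smul_apply, h2, Finsupp.single_eq_of_ne (Ne.symm h1)]
          simp
        have := hc k l h2
        omega
    · have h0 : c ((N : ℤ), (0 : ℤ)) = 0 := by
        by_contra h
        have := (hc _ _ h).1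
        simp only [Nat.abs_cast] at this
        omega
      rw [Finsupp.add_apply, Finsupp.smul_apply, h0, Finsupp.single_eq_same]
      simp [hδ0.ne']
  · rw [(hD x2).partialX_partialX, (hD y2).partialY_partialY]
    refine (add_le_add (normL1_smul_add_mono_le x1 _ _ _ x3)
      (normL1_smul_add_mono_le y1 _ _ _ y3)).trans ?_
    rw [← ENNReal.ofReal_add (by positivity) (by positivity)]
    refine ENNReal.ofReal_le_one.2 (le_of_eq ?_)
    have e : ‖(δ : ℂ) * (-((N : ℂ) * N))‖ = 1 / 4 := by
      rw [norm_mul, norm_neg, norm_mul, Complex.norm_real, Complex.norm_natCast,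
        Real.norm_of_nonneg hδ0.le, hδ]
      field_simp
    simp only [Int.cast_one, Int.cast_zero, mul_one, mul_zero, neg_zero, norm_zero, e]
    norm_num
  · rw [(hD z2).partialX_partialY]
    simp only [Int.cast_one, Int.cast_zero, mul_one, mul_zero, neg_zero, zero_smul, add_zero]
    rw [normL1_eq_of_mem_trigSpace (Submodule.smul_mem _ _ z1)]
    apply ENNReal.ofReal_le_ofReal
    simp only [Pi.smul_apply, smul_eq_mul, norm_mul]
    rw [integral_const_mul]
    norm_num
    linarith

theorem corollary1 :
    ∃ C : ℝ, 0 < C ∧ ∀ N : ℕ, 1 ≤ N → ∃ P : TrigPoly2,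
      trigDegree P = N ∧
      normL1 (partialX (partialX (trigFun P))) + normL1 (partialY (partialY (trigFun P))) ≤ 1 ∧
      ENNReal.ofReal (C * Real.log (N : ℝ) ^ (1 / 2 : ℝ)) <
        normL1 (partialX (partialY (trigFun P))) := by
  -- With L = (ln N)^{1/2} and n = ⌊L/4⌋ one has 16 n² ≤ L², so the degree bound holds. If n ≥ 16,
  -- then (n/8 - 1)/8 ≥ n/128, which exceeds (n + 1)/160 > L/640. If n ≤ 15, then L < 64 and L/640 <
  -- 1/10, below the 1/2 reached by a single monomial.
  refine ⟨1 / 640, by norm_num, fun N hN => ?_⟩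
  rw [← Real.sqrt_eq_rpow]
  have hlog : 0 ≤ Real.log N := Real.log_natCast_nonneg N
  set L := √(Real.log N) with hL
  have hL0 : 0 ≤ L := Real.sqrt_nonneg _
  have hL2 : L ^ 2 = Real.log N := Real.sq_sqrt hlog
  set n := ⌊L / 4⌋₊ with hn
  have hn1 : (n : ℝ) ≤ L / 4 := Nat.floor_le (by positivity)
  have hn2 : L / 4 < n + 1 := Nat.lt_floor_add_one _
  by_cases h16 : 16 ≤ n
  · have h16' : (16 : ℝ) ≤ n := by exact_mod_cast h16
    have hdeg : (25 * (2 * n + 1) ^ 5) ^ n ≤ N := by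
      have h1 := pow_lacunary_degree_le_exp n (by omega)
      have h2 : Real.exp (16 * (n : ℝ) ^ 2) ≤ N := by
        rw [← Real.le_log_iff_exp_le (by exact_mod_cast hN), ← hL2]
        nlinarith
      exact_mod_cast h1.trans h2
    obtain ⟨P, h1, h2, h3⟩ := exists_trigPoly_of_degree (by omega) hdeg
    refine ⟨P, h1, h2, lt_of_lt_of_le ?_ h3⟩
    rw [ENNReal.ofReal_lt_ofReal_iff (by linarith)]
    linarith
  · obtain ⟨P, h1, h2, h3⟩ := exists_trigPoly_trivial N hN
    refine ⟨P, h1, h2, ?_⟩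
    rw [h3, ENNReal.ofReal_lt_ofReal_iff (by norm_num)]
    have : (n : ℝ) ≤ 15 := by exact_mod_cast (by omega : n ≤ 15)
    linarith
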